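/- **Theorem.** Let $n\ge 2$ agents have i.i.d. values in $[0,1]$ with continuous distribution $F$, and write $v(q)=F^{-1}(q)$ and $R(q)=v(q)(1-q)$. A *position environment* is given by weights $1\ge w_1\ge\dots\ge w_n\ge 0$ (with $w_{n+1}=0$). A *rank-based auction* in it is given by weights $1\ge y_1\ge\dots\ge y_n\ge 0$ (with $y_{n+1}=0$) such that $\sum_{j\le k}y_j\le\sum_{j\le k}w_j$ for all $k\in[n]$: agents are ranked by their nonnegative bids, ties are broken uniformly at random, and the agent of rank $j$ is served with probability $y_j$. A *first-price* agent pays her bid when served, an *all-pay* agent always pays her bid. Revenue is the expected sum of payments in a symmetric Bayes–Nash equilibrium. Let $$x_k(q)=\sum_{i=0}^{k-1}\tbinom{n-1}{i}q^{n-1-i}(1-q)^i,\qquad x(q)=\sum_{k=1}^n (y_k-y_{k+1})\,x_k(q)$$ be the allocation rules (as functions of the quantile) of the $k$-highest-bids-win auction and of the auction $y$, and let $P_k=\int_0^1 x_k'(q)R(q)\,dq$ be the per-agent multi-unit revenues. From $N\ge1$ independent equilibrium bids with order statistics $b^{(1)}\le\dots\le b^{(N)}$ put $\hat b(q)=b^{(i)}$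 for $q\in[\frac{i-1}N,\frac iN)$ and, with $Z_k(q)=(1-q)\,x_k'(q)/x'(q)$, $$\hat P_k=-\int_0^1 x(q)Z_k'(q)\hat b(q)\,dq\ \text{ (first-price)},\qquad \hat P_k=-\int_0^1 Z_k'(q)\hat b(q)\,dq\ \text{ (all-pay)}.$$ Assume that the auction with weights $\frac nn,\frac{n-1}n,\dots,\frac1n$ (equal marginal weights) is a rank-based auction in the environment $w$; for instance $w=(1,\dots,1)$, where every rank-based auction is allowed. Then for every $0<\varepsilon\le1$ there is a rank-based auction $y$ in the environment $w$ such that: 1. $\sum_k (y_k-y_{k+1})P_k\ge(1-\varepsilon)\sum_k(y'_k-y'_{k+1})P_k$ for every rank-based auction $y'$ in $w$. In both formats $y$ has a symmetric Bayes–Nash equilibrium, and in every such equilibrium its revenue is at least $(1-\varepsilon)$ times the revenue of every symmetric Bayes–Nash equilibrium of every rank-based auction in $w$, in either format. 2. For every symmetric Bayes–Nash equilibrium of $y$, every $N\ge1$ and every $k\in[n]$, the estimator $\hat P_k$ has finite root mean squared error, bounded by $$\mathbb E\big[|\hat P_k-P_k|^2\big]^{1/2}\le\sqrt{\tfrac2N}\,\frac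 n\varepsilon\,\sup_{q\in[0,1]}\frac{x'(q)}{x(q)}\ \text{ (first-price)},\qquad \mathbb E\big[|\hat P_k-P_k|^2\big]^{1/2}\le\sqrt{\tfrac2N}\,\frac n\varepsilon\,\sup_{q\in[0,1]}x'(q)\ \text{ (all-pay)},$$ where both suprema are finite. -/

import Mathlib

open MeasureTheory ProbabilityTheory

/-- The two standard payment formats: pay your bid when served, or pay your bid always. -/
inductive PaymentFormat
  | firstPrice
  | allPay

namespace RankAuction

noncomputable section

/-! ### Position environments and rank-based auctions

Positions are numbered `0, …, n - 1`, so `w j` is the service probability of the `(j+1)`-st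
position. A rank-based auction is given by its induced position weights. -/

/-- Position weights `1 ≥ w₁ ≥ ⋯ ≥ wₙ ≥ 0`. -/
def IsPositionWeights {n : ℕ} (w : Fin n → ℝ) : Prop :=
  Antitone w ∧ ∀ j, 0 ≤ w j ∧ w j ≤ 1

/-- The weight of a position, extended by `0` beyond the last one. -/
def weightAt {n : ℕ} (w : Fin n → ℝ) (j : ℕ) : ℝ :=
  if h : j < n then w ⟨j, h⟩ else 0

/-- `y` are the induced position weights of a rank-based auction in the position environment `w`:
weight is only shifted downward or discarded, i.e. the cumulative weights of `y` are
dominated by those of `w`. -/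
def IsRankBasedAuction {n : ℕ} (w y : Fin n → ℝ) : Prop :=
  IsPositionWeights y ∧
    ∀ k ≤ n, ∑ j ∈ Finset.range k, weightAt y j ≤ ∑ j ∈ Finset.range k, weightAt w j

/-- The marginal weights `w_k - w_{k+1}` with the convention `w_{n+1} = 0`
(the argument `k` is the position number `k + 1`). -/
def marginalWeight {n : ℕ} (w : Fin n → ℝ) (k : Fin n) : ℝ :=
  w k - weightAt w (k + 1)

/-- The position weights `1, (n-1)/n, …, 1/n`: all `n` marginal weights are equal to `1/n`. -/
def equalMarginalWeights (n : ℕ) : Fin n → ℝ :=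
  fun j => ((n : ℝ) - (j : ℕ)) / n

/-- The service probability of agent `i` in the rank-based auction with position weights `w` at
the bid profile `β`: agents are ranked by bid, ties are broken uniformly at random (so the agents
in a tie share the average weight of the positions that they occupy). -/
def serviceProb {n : ℕ} (w : Fin n → ℝ) (β : Fin n → ℝ) (i : Fin n) : ℝ :=
  let above := (Finset.univ.filter fun j => β i < β j).card
  let tied := (Finset.univ.filter fun j => β j = β i).card
  (∑ l ∈ Finset.range tied, weightAt w (above + l)) / tied

/-- The expected payment of agent `i` at the bid profile `β`. -/
def payment (fmt : PaymentFormat) {n : ℕ} (w : Fin n → ℝ) (β : Fin n → ℝ) (i : Fin n) : ℝ :=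
  match fmt with
  | .firstPrice => β i * serviceProb w β i
  | .allPay => β i

/-! ### Bayes–Nash equilibrium -/

/-- The bid profile in which agent `i` bids `z` and every other agent `j`, with value `v j`,
bids `s (v j)`. -/
def deviate {n : ℕ} (s : ℝ → ℝ) (v : Fin n → ℝ) (i : Fin n) (z : ℝ) : Fin n → ℝ :=
  Function.update (fun j => s (v j)) i z

/-- Interim utility of agent `i` with value `x` and bid `z`, when the values of the others are
drawn independently from `F` and the others bid by the strategy `s`.  (The value `v i` is also
drawn below, but it does not enter the integrand.) -/
def interimUtility (fmt : PaymentFormat) {n : ℕ} (w : Fin n → ℝ) (F : Measure ℝ) (s : ℝ → ℝ)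
    (i : Fin n) (x z : ℝ) : ℝ :=
  x * (∫ v, serviceProb w (deviate s v i z) i ∂(Measure.pi fun _ : Fin n => F)) -
    ∫ v, payment fmt w (deviate s v i z) i ∂(Measure.pi fun _ : Fin n => F)

/-- The strategy `s`, used by all agents, is a Bayes–Nash equilibrium: values lie in `[0,1]`, bids
are nonnegative, and for every agent and every value no other bid is better. -/
structure IsSymmetricBNE (fmt : PaymentFormat) {n : ℕ} (w : Fin n → ℝ) (F : Measure ℝ)
    (s : ℝ → ℝ) : Prop where
  measurable : Measurable s
  nonneg : ∀ x, 0 ≤ s x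
  bestResponse : ∀ i : Fin n, ∀ x ∈ Set.Icc (0 : ℝ) 1, ∀ z : ℝ, 0 ≤ z →
    interimUtility fmt w F s i x z ≤ interimUtility fmt w F s i x (s x)

/-- Expected revenue: the expected sum of all payments when all agents bid by `s`. -/
def expectedRevenue (fmt : PaymentFormat) {n : ℕ} (w : Fin n → ℝ) (F : Measure ℝ)
    (s : ℝ → ℝ) : ℝ :=
  ∫ v, ∑ i, payment fmt w (fun j => s (v j)) i ∂(Measure.pi fun _ : Fin n => F)

/-! ### Quantile space -/

/-- The value as a function of the quantile, `v(q) = F⁻¹(q)`. -/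
def quantileValue (F : Measure ℝ) (q : ℝ) : ℝ :=
  sInf {z : ℝ | q ≤ cdf F z}

/-- The revenue curve `R(q) = v(q) (1 - q)`. -/
def revenueCurve (F : Measure ℝ) (q : ℝ) : ℝ :=
  quantileValue F q * (1 - q)

/-- The allocation rule `x_k` of the `k`-highest-bids-win auction with `n` agents. -/
def unitAlloc (n k : ℕ) (q : ℝ) : ℝ :=
  ∑ i ∈ Finset.range k, ((n - 1).choose i : ℝ) * q ^ (n - 1 - i) * (1 - q) ^ i

/-- The allocation rule `x` of the rank-based auction with position weights `w`. -/
def alloc {n : ℕ} (w : Fin n → ℝ) (q : ℝ) : ℝ :=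
  ∑ k : Fin n, marginalWeight w k * unitAlloc n (k + 1) q

/-- The (per-agent) multi-unit revenue `P_k = E_q[x_k'(q) R(q)]`. -/
def multiUnitRevenue (F : Measure ℝ) (n k : ℕ) : ℝ :=
  ∫ q in (0 : ℝ)..1, deriv (unitAlloc n k) q * revenueCurve F q

/-- The per-agent revenue `∑ₖ (w_k - w_{k+1}) P_k` of a rank-based auction in terms of the
multi-unit revenues. -/
def positionRevenue (F : Measure ℝ) {n : ℕ} (w : Fin n → ℝ) : ℝ :=
  ∑ k : Fin n, marginalWeight w k * multiUnitRevenue F n (k + 1)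

/-! ### Estimation from bid samples -/

/-- The estimated bid function: the `i`-th smallest sample on `[(i-1)/N, i/N)`, `1 ≤ i ≤ N`
(and, immaterially, `0` outside `[0,1)`). -/
def estimatedBid {N : ℕ} (B : Fin N → ℝ) (q : ℝ) : ℝ :=
  if h : 0 ≤ q ∧ ⌊q * N⌋₊ < N then B (Tuple.sort B ⟨⌊q * N⌋₊, h.2⟩) else 0

/-- `Z_k(q) = (1 - q) x_k'(q) / x'(q)`. -/
def zRatio {n : ℕ} (w : Fin n → ℝ) (k : ℕ) (q : ℝ) : ℝ :=
  (1 - q) * deriv (unitAlloc n k) q / deriv (alloc w) q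

/-- The estimator of `P_k` from a sample `B` of bids in the auction with position weights `w`:
`E_q[-x(q) Z_k'(q) b̂(q)]` in the first-price and `E_q[-Z_k'(q) b̂(q)]` in the all-pay format.
It depends on the auction and the sample only, not on the value distribution. -/
def estimatedRevenue (fmt : PaymentFormat) {n N : ℕ} (w : Fin n → ℝ) (k : ℕ)
    (B : Fin N → ℝ) : ℝ :=
  match fmt with
  | .firstPrice => ∫ q in (0 : ℝ)..1, -(alloc w q * deriv (zRatio w k) q * estimatedBid B q)
  | .allPay => ∫ q in (0 : ℝ)..1, -(deriv (zRatio w k) q * estimatedBid B q)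

/-- The quantity whose supremum over `q ∈ [0,1]` enters the error bound: `x'(q)/x(q)` in the
first-price and `x'(q)` in the all-pay format. -/
def allocSlope (fmt : PaymentFormat) {n : ℕ} (w : Fin n → ℝ) (q : ℝ) : ℝ :=
  match fmt with
  | .firstPrice => deriv (alloc w) q / alloc w q
  | .allPay => deriv (alloc w) q

end

end RankAuction

/-! The auction is the mixture y = (1 - ε) y_opt + ε e, where y_opt maximizes the multi-unit revenue
over the compact polytope of rank-based auctions and e has all marginal weights 1/n. Revenue is
linear in the weights and nonnegative at e, so at most a fraction ε is lost. In exchange every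
marginal weight of y is at least ε/n, and this alone drives the error bound.

Equilibria. If the weights are not all equal, equilibrium bids have no atoms, since overbidding an
atom gains a fixed amount of service at arbitrarily small cost (`IsSymmetricBNE.measure_bid_eq`).
Incentive compatibility then makes the quantile of the bid equal to the quantile of the value
(`IsSymmetricBNE.interimAlloc_eq`), and the envelope argument forces the interim payment at quantile
q to be B(q) = ∫_0^q v x' in both formats (`IsSymmetricBNE.bidPayment_eq`). Integrating B gives
revenue equivalence (`IsSymmetricBNE.expectedRevenue_eq`). Conversely, x > 0 on [0,1] for the
mixture, and bidding B/x or B is an equilibrium (`isSymmetricBNE_quantileBid`).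

Estimation. As Z_k v x' = x_k' R and Z_k(1) = 0, integration by parts gives P_k = -∫ Z_k' B
(`multiUnitRevenue_eq`). With B = x b or B = b, the error is -∫ A (b̂ - b), where A = x Z_k' or
Z_k'. Cauchy–Schwarz with weight |A| bounds the mean squared error by (∫ |A|)² times the supremum
over q of the mean squared error of b̂(q) (`integral_sq_integral_mul_le`). Two estimates remain.

First, ∫ |A| ≤ ∫ |Z_k'| ≤ 2 sup Z_k ≤ 2n/ε (`integral_abs_deriv_zRatio_le`). The last step holds
because x' ≥ (ε/n) x_k'. The middle one is unimodality: in the odds t = q/(1 - q), the reciprocal of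
a nonzero Z_k is a Laurent polynomial V with nonnegative coefficients, so t V'(t) is nondecreasing
and V falls before it rises.

Second, b is increasing and Lipschitz with constant L = sup x'/x or sup x', so the error of b̂(q) is
at most L times the distance from q to an order statistic of N uniform quantiles, whose mean square
is at most 1/(2N) (`integral_orderStat_sub_sq_le`). The product (2n/ε)² L² / (2N) is the square of
the claimed bound. -/

namespace RankAuction

/-! ### Bernstein polynomials and allocation rules -/

/-- The probability that exactly `i` of `m` independent uniform quantiles exceed `q`. -/
def bern (m i : ℕ) (q : ℝ) : ℝ :=
  (m.choose i : ℝ) * q ^ (m - i) * (1 - q) ^ i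

theorem bern_eq_eval (m i : ℕ) (q : ℝ) :
    bern m i q = (bernsteinPolynomial ℝ m i).eval (1 - q) := by
  simp [bern, bernsteinPolynomial]
  ring

theorem bern_nonneg (m i : ℕ) {q : ℝ} (hq : q ∈ Set.Icc (0 : ℝ) 1) : 0 ≤ bern m i q := by
  have h0 := hq.1
  have h1 := sub_nonneg.2 hq.2
  unfold bern
  positivity

theorem bern_pos {m i : ℕ} (hi : i ≤ m) {q : ℝ} (hq : q ∈ Set.Ioo (0 : ℝ) 1) : 0 < bern m i q := by
  have h0 := hq.1
  have h1 := sub_pos.2 hq.2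
  have := Nat.choose_pos hi
  unfold bern
  positivity

theorem sum_bern (m : ℕ) (q : ℝ) : ∑ i ∈ Finset.range (m + 1), bern m i q = 1 := by
  simp_rw [bern_eq_eval, ← Polynomial.eval_finsetSum, bernsteinPolynomial.sum]
  simp

theorem continuous_bern (m i : ℕ) : Continuous (bern m i) := by
  unfold bern
  fun_prop

theorem hasDerivAt_bern_zero (m : ℕ) (q : ℝ) :
    HasDerivAt (bern m 0) (m * bern (m - 1) 0 q) q := by
  have : bern m 0 = fun q => q ^ m := by ext; simp [bern]
  rw [this]
  simpa [bern] using hasDerivAt_pow m q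

theorem hasDerivAt_bern_succ (m i : ℕ) (q : ℝ) :
    HasDerivAt (bern m (i + 1)) (m * (bern (m - 1) (i + 1) q - bern (m - 1) i q)) q := by
  have h1 : bern m (i + 1) = fun q => (bernsteinPolynomial ℝ m (i + 1)).eval (1 - q) := by
    ext; rw [bern_eq_eval]
  rw [h1]
  have h2 := ((bernsteinPolynomial ℝ m (i + 1)).hasDerivAt (1 - q)).comp q
    ((hasDerivAt_id q).const_sub 1)
  refine h2.congr_deriv ?_
  rw [bernsteinPolynomial.derivative_succ]
  simp [bern_eq_eval]
  ring

theorem unitAlloc_eq_sum_bern (n k : ℕ) (q : ℝ) :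
    unitAlloc n k q = ∑ i ∈ Finset.range k, bern (n - 1) i q := rfl

/-- The derivatives of consecutive Bernstein terms telescope, so that a single term of degree `n -
2` survives. -/
theorem hasDerivAt_unitAlloc_succ (n k : ℕ) (q : ℝ) :
    HasDerivAt (unitAlloc n (k + 1)) (((n - 1 : ℕ) : ℝ) * bern (n - 2) k q) q := by
  have h : ∀ k, unitAlloc n (k + 1) = fun q => ∑ i ∈ Finset.range (k + 1), bern (n - 1) i q :=
    fun k => funext (unitAlloc_eq_sum_bern n _)
  induction k with
  | zero =>
    rw [h]
    simpa [Nat.sub_sub] using hasDerivAt_bern_zero (n - 1) q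
  | succ k ih =>
    have h2 : unitAlloc n (k + 1 + 1) = unitAlloc n (k + 1) + bern (n - 1) (k + 1) := by
      ext q
      rw [Pi.add_apply, unitAlloc_eq_sum_bern, Finset.sum_range_succ, unitAlloc_eq_sum_bern]
    rw [h2]
    refine (ih.add (hasDerivAt_bern_succ (n - 1) k q)).congr_deriv ?_
    rw [Nat.sub_sub]
    ring

theorem deriv_unitAlloc_succ (n k : ℕ) :
    deriv (unitAlloc n (k + 1)) = fun q => ((n - 1 : ℕ) : ℝ) * bern (n - 2) k q :=
  funext fun q => (hasDerivAt_unitAlloc_succ n k q).deriv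

/-- Abel summation, used to pass from marginal weights to position weights. -/
theorem sum_sub_mul_sum (a b : ℕ → ℝ) (m : ℕ) :
    ∑ k ∈ Finset.range m, (a k - a (k + 1)) * ∑ i ∈ Finset.range (k + 1), b i =
      ∑ i ∈ Finset.range m, a i * b i - a m * ∑ i ∈ Finset.range m, b i := by
  induction m with
  | zero => simp
  | succ m ih =>
    rw [Finset.sum_range_succ, ih, Finset.sum_range_succ, Finset.sum_range_succ]
    ring

theorem weightAt_coe {n : ℕ} (w : Fin n → ℝ) (k : Fin n) : weightAt w k = w k := by
  simp [weightAt]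

theorem weightAt_of_le {n : ℕ} (w : Fin n → ℝ) {k : ℕ} (h : n ≤ k) : weightAt w k = 0 := by
  simp [weightAt, not_lt.2 h]

theorem IsPositionWeights.antitone_weightAt {n : ℕ} {w : Fin n → ℝ} (hw : IsPositionWeights w) :
    Antitone (weightAt w) := by
  intro i j hij
  unfold weightAt
  by_cases hj : j < n
  · rw [dif_pos hj, dif_pos (hij.trans_lt hj)]
    exact hw.1 hij
  · rw [dif_neg hj]
    split_ifs
    · exact (hw.2 _).1
    · exact le_rfl

theorem IsPositionWeights.weightAt_nonneg {n : ℕ} {w : Fin n → ℝ} (hw : IsPositionWeights w)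
    (i : ℕ) : 0 ≤ weightAt w i := by
  unfold weightAt
  split_ifs
  · exact (hw.2 _).1
  · exact le_rfl

theorem IsPositionWeights.weightAt_le_one {n : ℕ} {w : Fin n → ℝ} (hw : IsPositionWeights w)
    (i : ℕ) : weightAt w i ≤ 1 := by
  unfold weightAt
  split_ifs
  · exact (hw.2 _).2
  · exact zero_le_one

theorem IsPositionWeights.marginalWeight_nonneg {n : ℕ} {w : Fin n → ℝ} (hw : IsPositionWeights w)
    (k : Fin n) : 0 ≤ marginalWeight w k := by
  have := hw.antitone_weightAt (Nat.le_succ k)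
  rw [weightAt_coe] at this
  exact sub_nonneg.2 this

/-- The rule as an expected weight: `bern (n - 1) i q` is the probability that exactly `i` opponents
rank above quantile `q`. The boundary term of the Abel summation vanishes because the weight beyond
the last position is zero. -/
theorem alloc_eq_sum_bern {n : ℕ} (w : Fin n → ℝ) (q : ℝ) :
    alloc w q = ∑ i ∈ Finset.range n, weightAt w i * bern (n - 1) i q := by
  have h := sum_sub_mul_sum (weightAt w) (fun i => bern (n - 1) i q) n
  rw [weightAt_of_le w le_rfl, zero_mul, sub_zero] at h
  rw [← h, Finset.sum_range, alloc]
  simp only [marginalWeight, weightAt_coe, unitAlloc_eq_sum_bern]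

theorem hasDerivAt_alloc {n : ℕ} (w : Fin n → ℝ) (q : ℝ) :
    HasDerivAt (alloc w)
      (∑ k : Fin n, marginalWeight w k * (((n - 1 : ℕ) : ℝ) * bern (n - 2) k q)) q := by
  unfold alloc
  exact HasDerivAt.fun_sum fun k _ => (hasDerivAt_unitAlloc_succ n k q).const_mul _

theorem deriv_alloc {n : ℕ} (w : Fin n → ℝ) :
    deriv (alloc w) = fun q =>
      ∑ k : Fin n, marginalWeight w k * (((n - 1 : ℕ) : ℝ) * bern (n - 2) k q) :=
  funext fun q => (hasDerivAt_alloc w q).deriv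

theorem continuous_alloc {n : ℕ} (w : Fin n → ℝ) : Continuous (alloc w) :=
  continuous_iff_continuousAt.2 fun q => (hasDerivAt_alloc w q).continuousAt

theorem continuous_deriv_alloc {n : ℕ} (w : Fin n → ℝ) : Continuous (deriv (alloc w)) := by
  rw [deriv_alloc]
  exact continuous_finsetSum _ fun k _ =>
    continuous_const.mul (continuous_const.mul (continuous_bern _ _))

theorem differentiable_alloc {n : ℕ} (w : Fin n → ℝ) : Differentiable ℝ (alloc w) :=
  fun q => (hasDerivAt_alloc w q).differentiableAt

/-! ### Bounds and strict monotonicity of the allocation rule -/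

section Bounds

variable {n : ℕ} {w : Fin n → ℝ}

theorem IsPositionWeights.deriv_alloc_nonneg (hw : IsPositionWeights w) {q : ℝ}
    (hq : q ∈ Set.Icc (0 : ℝ) 1) : 0 ≤ deriv (alloc w) q := by
  rw [deriv_alloc]
  exact Finset.sum_nonneg fun k _ => mul_nonneg (hw.marginalWeight_nonneg k)
    (mul_nonneg (Nat.cast_nonneg _) (bern_nonneg _ _ hq))

theorem IsPositionWeights.monotoneOn_alloc (hw : IsPositionWeights w) :
    MonotoneOn (alloc w) (Set.Icc 0 1) :=
  monotoneOn_of_deriv_nonneg (convex_Icc 0 1) (continuous_alloc w).continuousOn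
    (differentiable_alloc w).differentiableOn
    fun _ hq => hw.deriv_alloc_nonneg (interior_subset hq)

theorem IsPositionWeights.alloc_nonneg (hw : IsPositionWeights w) {q : ℝ}
    (hq : q ∈ Set.Icc (0 : ℝ) 1) : 0 ≤ alloc w q := by
  rw [alloc_eq_sum_bern]
  exact Finset.sum_nonneg fun i _ => mul_nonneg (hw.weightAt_nonneg i) (bern_nonneg _ _ hq)

theorem IsPositionWeights.alloc_le_one (hw : IsPositionWeights w) {q : ℝ}
    (hq : q ∈ Set.Icc (0 : ℝ) 1) : alloc w q ≤ 1 := by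
  rw [alloc_eq_sum_bern]
  rcases n with _ | n
  · simp
  calc ∑ i ∈ Finset.range (n + 1), weightAt w i * bern (n + 1 - 1) i q
      ≤ ∑ i ∈ Finset.range (n + 1), bern n i q := Finset.sum_le_sum fun i _ =>
        mul_le_of_le_one_left (bern_nonneg _ _ hq) (hw.weightAt_le_one i)
    _ = 1 := sum_bern n q

theorem weightAt_last_le_alloc (hw : IsPositionWeights w) (hn : 0 < n) {q : ℝ}
    (hq : q ∈ Set.Icc (0 : ℝ) 1) : weightAt w (n - 1) ≤ alloc w q := by
  rw [alloc_eq_sum_bern]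
  obtain ⟨n, rfl⟩ := Nat.exists_eq_succ_of_ne_zero hn.ne'
  calc weightAt w (n + 1 - 1) = weightAt w n * ∑ i ∈ Finset.range (n + 1), bern n i q := by
        rw [sum_bern, mul_one]; rfl
    _ = ∑ i ∈ Finset.range (n + 1), weightAt w n * bern n i q := Finset.mul_sum _ _ _
    _ ≤ _ := Finset.sum_le_sum fun i hi => mul_le_mul_of_nonneg_right
        (hw.antitone_weightAt (Nat.lt_succ_iff.1 (Finset.mem_range.1 hi))) (bern_nonneg _ _ hq)

/-- If not all weights agree, some marginal weight other than the last is positive. -/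
theorem IsPositionWeights.exists_marginalWeight_pos (hw : IsPositionWeights w) {i j : Fin n}
    (hij : w i ≠ w j) : ∃ k : Fin n, (k : ℕ) + 1 < n ∧ 0 < marginalWeight w k := by
  by_contra! h
  have hstep : ∀ k : ℕ, k + 1 < n → weightAt w (k + 1) = weightAt w k := by
    intro k hk
    have h1 := h ⟨k, by omega⟩ hk
    have h2 := hw.marginalWeight_nonneg ⟨k, by omega⟩
    have h3 : marginalWeight w ⟨k, by omega⟩ = weightAt w k - weightAt w (k + 1) := by
      rw [marginalWeight, ← weightAt_coe w]
    linarith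
  have hconst : ∀ k : ℕ, k < n → weightAt w k = weightAt w 0 := by
    intro k
    induction k with
    | zero => simp
    | succ k ih => intro hk; rw [hstep k hk, ih (by omega)]
  apply hij
  rw [← weightAt_coe w, ← weightAt_coe w, hconst i i.2, hconst j j.2]

/-- The last marginal weight multiplies the constant rule that serves everybody. Any earlier
positive one contributes a Bernstein term that is positive inside the interval. -/
theorem IsPositionWeights.strictMonoOn_alloc (hw : IsPositionWeights w) {i j : Fin n}
    (hij : w i ≠ w j) : StrictMonoOn (alloc w) (Set.Icc 0 1) := by
  refine strictMonoOn_of_deriv_pos (convex_Icc 0 1) (continuous_alloc w).continuousOn fun q hq => ?_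
  rw [interior_Icc] at hq
  obtain ⟨k, hk, hpos⟩ := hw.exists_marginalWeight_pos hij
  rw [deriv_alloc]
  refine Finset.sum_pos' (fun k _ => mul_nonneg (hw.marginalWeight_nonneg k)
    (mul_nonneg (Nat.cast_nonneg _) (bern_nonneg _ _ (Set.Ioo_subset_Icc_self hq))))
    ⟨k, Finset.mem_univ k, ?_⟩
  have : (0 : ℝ) < ((n - 1 : ℕ) : ℝ) := Nat.cast_pos.2 (by omega)
  exact mul_pos hpos (mul_pos this (bern_pos (by omega) hq))

end Bounds

/-! ### Distribution functions and product measures -/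

section Cdf

variable (μ : Measure ℝ) [IsProbabilityMeasure μ]

theorem nullSingletonClass_of_continuous_cdf (h : Continuous (cdf μ)) : NullSingletonClass μ where
  measure_singleton x := by
    rw [← measure_cdf μ, StieltjesFunction.measure_singleton,
      (h.continuousAt.continuousWithinAt).leftLim_eq]
    simp

/-- A compact subset of a level set lies between its minimum and its maximum, where the distribution
function agrees, so it has no mass; inner regularity concludes. -/
theorem measure_setOf_cdf_eq [NullSingletonClass μ] (c : ℝ) : μ {x | cdf μ x = c} = 0 := by
  by_contra hne
  have hmeas : MeasurableSet {x | cdf μ x = c} :=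
    measurableSet_eq_fun (monotone_cdf μ).measurable measurable_const
  obtain ⟨K, hKS, hK, hpos⟩ := hmeas.exists_lt_isCompact (pos_iff_ne_zero.2 hne)
  have hKne : K.Nonempty := nonempty_of_measure_ne_zero hpos.ne'
  have hsub : K ⊆ Set.Icc (sInf K) (sSup K) := subset_Icc_csInf_csSup hK.bddBelow hK.bddAbove
  have hIcc : μ (Set.Icc (sInf K) (sSup K)) = 0 := by
    rw [← measure_congr (Ioc_ae_eq_Icc (μ := μ))]
    conv_lhs => rw [← measure_cdf μ]
    rw [StieltjesFunction.measure_Ioc, (hKS (hK.sInf_mem hKne) : cdf μ _ = c),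
      (hKS (hK.sSup_mem hKne) : cdf μ _ = c)]
    simp
  exact hpos.ne' (measure_mono_null hsub hIcc)

theorem measureReal_setOf_cdf_le [NullSingletonClass μ] (z : ℝ) :
    μ.real {x | cdf μ x ≤ cdf μ z} = cdf μ z := by
  conv_rhs => rw [cdf_eq_real]
  refine measureReal_congr (Filter.eventuallyEq_set.2 ?_)
  have h0 : ∀ᵐ x ∂μ, cdf μ x ≠ cdf μ z := measure_eq_zero_iff_ae_notMem.1
    (measure_setOf_cdf_eq μ (cdf μ z))
  filter_upwards [h0] with x hx
  refine ⟨fun h => ?_, fun h => monotone_cdf μ h⟩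
  by_contra hlt
  exact hx (le_antisymm h (monotone_cdf μ (not_le.1 hlt).le))

theorem measureReal_setOf_cdf_lt [NullSingletonClass μ] (z : ℝ) :
    μ.real {x | cdf μ x < cdf μ z} = cdf μ z := by
  conv_rhs => rw [← measureReal_setOf_cdf_le μ z]
  refine measureReal_congr (Filter.eventuallyEq_set.2 ?_)
  have h0 : ∀ᵐ x ∂μ, cdf μ x ≠ cdf μ z := measure_eq_zero_iff_ae_notMem.1
    (measure_setOf_cdf_eq μ (cdf μ z))
  filter_upwards [h0] with x hx
  exact ⟨fun h => le_of_lt h, fun h => lt_of_le_of_ne h hx⟩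

variable {μ}

omit [IsProbabilityMeasure μ] in
theorem cdf_mem_Icc (x : ℝ) : cdf μ x ∈ Set.Icc (0 : ℝ) 1 := ⟨cdf_nonneg μ x, cdf_le_one μ x⟩

theorem ae_mem_Icc_of_measure_eq_one (hμ : μ (Set.Icc 0 1) = 1) :
    ∀ᵐ x ∂μ, x ∈ Set.Icc (0 : ℝ) 1 :=
  mem_ae_iff.2 ((prob_compl_eq_zero_iff measurableSet_Icc).2 hμ)

theorem cdf_zero_of_measure_Icc [NullSingletonClass μ] (hμ : μ (Set.Icc 0 1) = 1) : cdf μ 0 = 0 := by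
  rw [cdf_eq_real, measureReal_eq_zero_iff, measure_eq_zero_iff_ae_notMem]
  have h0 : ∀ᵐ x ∂μ, x ≠ 0 := measure_eq_zero_iff_ae_notMem.1 (measure_singleton (μ := μ) 0)
  filter_upwards [ae_mem_Icc_of_measure_eq_one hμ, h0] with x hx hx0 hle
  exact hx0 (le_antisymm hle hx.1)

theorem cdf_one_of_measure_Icc (hμ : μ (Set.Icc 0 1) = 1) : cdf μ 1 = 1 := by
  rw [cdf_eq_real, measureReal_def, (prob_le_one (μ := μ)).antisymm
    (hμ.symm.le.trans (measure_mono Set.Icc_subset_Iic_self)), ENNReal.toReal_one]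

theorem exists_cdf_eq [NullSingletonClass μ] (hμ : μ (Set.Icc 0 1) = 1) (hc : Continuous (cdf μ)) {q : ℝ}
    (hq : q ∈ Set.Icc (0 : ℝ) 1) : ∃ z ∈ Set.Icc (0 : ℝ) 1, cdf μ z = q := by
  have := intermediate_value_Icc zero_le_one hc.continuousOn
  rw [cdf_zero_of_measure_Icc hμ, cdf_one_of_measure_Icc hμ] at this
  exact this hq

/-- The probability integral transform. -/
theorem map_cdf_eq_restrict [NullSingletonClass μ] (hμ : μ (Set.Icc 0 1) = 1) (hc : Continuous (cdf μ)) :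
    μ.map (cdf μ) = volume.restrict (Set.Icc 0 1) := by
  have : IsProbabilityMeasure (μ.map (cdf μ)) :=
    Measure.isProbabilityMeasure_map hc.measurable.aemeasurable
  refine Measure.ext_of_Iic _ _ fun a => ?_
  rw [Measure.map_apply hc.measurable measurableSet_Iic, Measure.restrict_apply measurableSet_Iic]
  rcases lt_or_ge a 0 with ha | ha
  · have h1 : cdf μ ⁻¹' Set.Iic a = ∅ :=
      Set.eq_empty_of_forall_notMem fun x hx => (cdf_nonneg μ x).not_gt (lt_of_le_of_lt hx ha)
    have h2 : Set.Iic a ∩ Set.Icc (0 : ℝ) 1 = ∅ :=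
      Set.eq_empty_of_forall_notMem fun x hx => (hx.2.1.trans hx.1).not_gt ha
    rw [h1, h2, measure_empty, measure_empty]
  rcases le_or_gt a 1 with ha1 | ha1
  · obtain ⟨z, -, rfl⟩ := exists_cdf_eq hμ hc ⟨ha, ha1⟩
    have h2 : Set.Iic (cdf μ z) ∩ Set.Icc (0 : ℝ) 1 = Set.Icc 0 (cdf μ z) := by
      ext x
      simp only [Set.mem_inter_iff, Set.mem_Iic, Set.mem_Icc]
      exact ⟨fun h => ⟨h.2.1, h.1⟩, fun h => ⟨h.2, h.1, h.2.trans ha1⟩⟩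
    rw [h2, Real.volume_Icc, sub_zero]
    have := measureReal_setOf_cdf_le μ z
    rw [← this, ofReal_measureReal, this]
    rfl
  · have h1 : cdf μ ⁻¹' Set.Iic a = Set.univ :=
      Set.eq_univ_of_forall fun x => (cdf_le_one μ x).trans ha1.le
    have h2 : Set.Iic a ∩ Set.Icc (0 : ℝ) 1 = Set.Icc 0 1 :=
      Set.inter_eq_right.2 fun x hx => hx.2.trans ha1.le
    rw [h1, h2, measure_univ, Real.volume_Icc]
    simp

/-- Continuity makes the superlevel set closed, so its infimum is attained. Positivity of `q` is
what bounds that set below. -/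
theorem quantileValue_le_iff (hμ : μ (Set.Icc 0 1) = 1) (hc : Continuous (cdf μ)) {q x : ℝ}
    (hq : q ∈ Set.Ioc (0 : ℝ) 1) : quantileValue μ q ≤ x ↔ q ≤ cdf μ x := by
  have := nullSingletonClass_of_continuous_cdf μ hc
  have hne : {z : ℝ | q ≤ cdf μ z}.Nonempty := ⟨1, by
    rw [Set.mem_ofPred_eq, cdf_one_of_measure_Icc hμ]; exact hq.2⟩
  have hbdd : BddBelow {z : ℝ | q ≤ cdf μ z} := ⟨0, fun z hz => by
    by_contra hz0
    have := (monotone_cdf μ (not_le.1 hz0).le).trans_eq (cdf_zero_of_measure_Icc hμ)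
    exact (hq.1.trans_le hz).not_ge this⟩
  have hclosed : IsClosed {z : ℝ | q ≤ cdf μ z} := isClosed_le continuous_const hc
  constructor
  · intro h
    exact (hclosed.csInf_mem hne hbdd : q ≤ cdf μ (sInf _)).trans (monotone_cdf μ h)
  · exact fun h => csInf_le hbdd h

-- Here the infimum runs over the whole line and takes the default value `0`, which keeps the
-- quantile function monotone with values in `[0,1]` at the endpoint.
omit [IsProbabilityMeasure μ] in
theorem quantileValue_of_nonpos {q : ℝ} (hq : q ≤ 0) : quantileValue μ q = 0 := by
  have : {z : ℝ | q ≤ cdf μ z} = Set.univ :=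
    Set.eq_univ_of_forall fun z => hq.trans (cdf_nonneg μ z)
  rw [quantileValue, this, Real.sInf_univ]

theorem quantileValue_mem_Icc (hμ : μ (Set.Icc 0 1) = 1) (hc : Continuous (cdf μ)) {q : ℝ}
    (hq : q ∈ Set.Icc (0 : ℝ) 1) : quantileValue μ q ∈ Set.Icc (0 : ℝ) 1 := by
  have := nullSingletonClass_of_continuous_cdf μ hc
  rcases hq.1.eq_or_lt with rfl | h0
  · rw [quantileValue_of_nonpos le_rfl]
    exact ⟨le_rfl, zero_le_one⟩
  · constructor
    · by_contra hlt
      have h1 := (quantileValue_le_iff hμ hc ⟨h0, hq.2⟩).1 le_rfl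
      have h2 := (monotone_cdf μ (not_le.1 hlt).le).trans_eq (cdf_zero_of_measure_Icc hμ)
      exact (h0.trans_le h1).not_ge h2
    · rw [quantileValue_le_iff hμ hc ⟨h0, hq.2⟩, cdf_one_of_measure_Icc hμ]
      exact hq.2

theorem quantileValue_pos (hμ : μ (Set.Icc 0 1) = 1) (hc : Continuous (cdf μ)) {q : ℝ}
    (hq : q ∈ Set.Ioc (0 : ℝ) 1) : 0 < quantileValue μ q := by
  have := nullSingletonClass_of_continuous_cdf μ hc
  rw [← not_le, quantileValue_le_iff hμ hc hq, cdf_zero_of_measure_Icc hμ]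
  exact not_le.2 hq.1

theorem monotoneOn_quantileValue (hμ : μ (Set.Icc 0 1) = 1) (hc : Continuous (cdf μ)) :
    MonotoneOn (quantileValue μ) (Set.Icc 0 1) := by
  intro p hp q hq hpq
  rcases hp.1.eq_or_lt with rfl | h0
  · rw [quantileValue_of_nonpos le_rfl]
    exact (quantileValue_mem_Icc hμ hc hq).1
  · rw [quantileValue_le_iff hμ hc ⟨h0, hp.2⟩]
    exact hpq.trans ((quantileValue_le_iff hμ hc ⟨h0.trans_le hpq, hq.2⟩).1 le_rfl)

theorem intervalIntegrable_quantileValue (hμ : μ (Set.Icc 0 1) = 1) (hc : Continuous (cdf μ)) :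
    IntervalIntegrable (quantileValue μ) volume 0 1 := by
  apply MonotoneOn.intervalIntegrable
  rw [Set.uIcc_of_le zero_le_one]
  exact monotoneOn_quantileValue hμ hc

end Cdf

/-! ### Product measures: resampling a coordinate and binomial counts -/

section Pi

variable {ι : Type*} [Fintype ι] [DecidableEq ι] {μ : Measure ℝ} [IsProbabilityMeasure μ]

/-- Resampling one coordinate independently does not change the product law. This separates an
agent's own value from those of her opponents. -/
theorem measurePreserving_update (i : ι) :
    MeasurePreserving (fun p : ℝ × (ι → ℝ) => Function.update p.2 i p.1)
      (μ.prod (Measure.pi fun _ => μ)) (Measure.pi fun _ => μ) := by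
  have hmeas : Measurable fun p : ℝ × (ι → ℝ) => Function.update p.2 i p.1 := by
    rw [measurable_pi_iff]
    intro j
    by_cases hj : j = i
    · subst hj
      simpa using measurable_fst
    · simp only [Function.update_of_ne hj]
      exact (measurable_pi_apply j).comp measurable_snd
  refine ⟨hmeas, (Measure.pi_eq fun s hs => ?_).symm⟩
  rw [Measure.map_apply hmeas (MeasurableSet.univ_pi hs)]
  have : (fun p : ℝ × (ι → ℝ) => Function.update p.2 i p.1) ⁻¹' (Set.univ.pi s) =
      s i ×ˢ Set.univ.pi (Function.update s i Set.univ) := by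
    ext ⟨x, v⟩
    simp only [Set.mem_preimage, Set.mem_univ_pi, Set.mem_prod]
    constructor
    · intro h
      refine ⟨by simpa using h i, fun j => ?_⟩
      by_cases hj : j = i
      · subst hj; simp
      · simpa [Function.update_of_ne hj] using h j
    · rintro ⟨hx, h⟩ j
      by_cases hj : j = i
      · subst hj; simpa using hx
      · simpa [Function.update_of_ne hj] using h j
  rw [this, Measure.prod_prod, Measure.pi_pi, ← Finset.mul_prod_erase _ _ (Finset.mem_univ i),
    ← Finset.mul_prod_erase _ _ (Finset.mem_univ i)]
  simp only [Function.update_self, measure_univ, one_mul]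
  congr 1
  refine Finset.prod_congr rfl fun j hj => ?_
  rw [Function.update_of_ne (Finset.ne_of_mem_erase hj)]

/-- The number of coordinates in `T` that land in `A` has a binomial distribution. -/
theorem integral_card_filter_mem {A : Set ℝ} (hA : MeasurableSet A) [DecidablePred (· ∈ A)]
    (T : Finset ι) (φ : ℕ → ℝ) :
    ∫ v : ι → ℝ, φ (T.filter fun j => v j ∈ A).card ∂(Measure.pi fun _ => μ) =
      ∑ m ∈ Finset.range (T.card + 1), φ m * ((T.card.choose m : ℝ) *
        (1 - μ.real A) ^ (T.card - m) * μ.real A ^ m) := by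
  classical
  -- The product of `g S j (v j)` over `j` is the indicator that the coordinates in `T` landing in
  -- `A` are exactly `S`. Independence then factors its expectation.
  let g : Finset ι → ι → ℝ → ℝ := fun S j x => if j ∈ T → (x ∈ A ↔ j ∈ S) then 1 else 0
  have hpt : ∀ v : ι → ℝ, φ (T.filter fun j => v j ∈ A).card =
      ∑ S ∈ T.powerset, φ S.card * ∏ j, g S j (v j) := by
    intro v
    rw [Finset.sum_eq_single (T.filter fun j => v j ∈ A)]
    · have : ∏ j, g (T.filter fun j => v j ∈ A) j (v j) = 1 :=
        Finset.prod_eq_one fun j _ => if_pos fun hj => by simp [hj]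
      rw [this, mul_one]
    · intro S hS hne
      obtain ⟨j, hj⟩ : ∃ j, ¬(j ∈ T → (v j ∈ A ↔ j ∈ S)) := by
        by_contra! h
        apply hne
        ext j
        rw [Finset.mem_filter]
        constructor
        · exact fun hj => ⟨Finset.mem_powerset.1 hS hj, (h j (Finset.mem_powerset.1 hS hj)).2 hj⟩
        · exact fun hj => (h j hj.1).1 hj.2
      rw [Finset.prod_eq_zero (Finset.mem_univ j) (if_neg hj), mul_zero]
    · intro h
      exact absurd (Finset.mem_powerset.2 (Finset.filter_subset _ _)) h
  have hgmeas : ∀ S j, Measurable (g S j) := fun S j => by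
    refine Measurable.ite ?_ measurable_const measurable_const
    by_cases h1 : j ∈ T <;> by_cases h2 : j ∈ S <;> simp [h1, h2, hA]
    exact measurableSet_setOfPred.1 hA.compl
  have hgint : ∀ S j, ∫ x, g S j x ∂μ =
      if j ∈ T then (if j ∈ S then μ.real A else 1 - μ.real A) else 1 := by
    intro S j
    by_cases h1 : j ∈ T
    · by_cases h2 : j ∈ S
      · have : g S j = A.indicator 1 := by ext x; simp [g, h1, h2, Set.indicator_apply]
        rw [this, integral_indicator_one hA]
        simp [h1, h2]
      · have : g S j = Aᶜ.indicator 1 := by ext x; simp [g, h1, h2, Set.indicator_apply]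
        rw [this, integral_indicator_one hA.compl, probReal_compl_eq_one_sub hA]
        simp [h1, h2]
    · simp [g, h1]
  have hint : ∀ S ∈ T.powerset, Integrable (fun v : ι → ℝ => φ S.card * ∏ j, g S j (v j))
      (Measure.pi fun _ => μ) := by
    intro S _
    refine Integrable.const_mul ?_ _
    refine Integrable.of_bound (C := 1) (Finset.measurable_prod _ fun j _ =>
      (hgmeas S j).comp (measurable_pi_apply j)).aestronglyMeasurable (ae_of_all _ fun v => ?_)
    rw [Real.norm_eq_abs, Finset.abs_prod]
    refine Finset.prod_le_one (fun _ _ => abs_nonneg _) fun j _ => ?_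
    simp only [g]
    split_ifs <;> simp
  simp_rw [hpt]
  rw [integral_finsetSum _ hint]
  have hval : ∀ S ∈ T.powerset, ∫ v : ι → ℝ, φ S.card * ∏ j, g S j (v j)
      ∂(Measure.pi fun _ => μ) =
        φ S.card * (μ.real A ^ S.card * (1 - μ.real A) ^ (T.card - S.card)) := by
    intro S hS
    rw [integral_const_mul, integral_fintype_prod_eq_prod]
    simp_rw [hgint]
    rw [Finset.prod_ite_mem, Finset.univ_inter, Finset.prod_ite, Finset.prod_const,
      Finset.prod_const]
    have h1 : T.filter (· ∈ S) = S := by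
      rw [Finset.filter_mem_eq_inter, Finset.inter_eq_right.2 (Finset.mem_powerset.1 hS)]
    have h2 : T.filter (· ∉ S) = T \ S := by
      ext; simp
    rw [h1, h2, Finset.card_sdiff_of_subset (Finset.mem_powerset.1 hS)]
  rw [Finset.sum_congr rfl hval, Finset.sum_powerset_apply_card
    (fun m => φ m * (μ.real A ^ m * (1 - μ.real A) ^ (T.card - m)))]
  refine Finset.sum_congr rfl fun m _ => ?_
  rw [nsmul_eq_mul]
  ring

end Pi

/-! ### Service probabilities -/

section Service

variable {n : ℕ} {w : Fin n → ℝ}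

theorem measurable_serviceProb (w : Fin n → ℝ) (i : Fin n) :
    Measurable fun β : Fin n → ℝ => serviceProb w β i := by
  have h1 : Measurable fun β : Fin n → ℝ => (Finset.univ.filter fun j => β i < β j).card := by
    simp_rw [Finset.card_filter]
    exact Finset.measurable_sum _ fun j _ => Measurable.ite
      (measurableSet_lt (measurable_pi_apply i) (measurable_pi_apply j))
      measurable_const measurable_const
  have h2 : Measurable fun β : Fin n → ℝ => (Finset.univ.filter fun j => β j = β i).card := by
    simp_rw [Finset.card_filter]
    exact Finset.measurable_sum _ fun j _ => Measurable.ite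
      (measurableSet_eq_fun (measurable_pi_apply j) (measurable_pi_apply i))
      measurable_const measurable_const
  have h3 : Measurable (Function.uncurry fun a t : ℕ =>
      (∑ l ∈ Finset.range t, weightAt w (a + l)) / (t : ℝ)) := Measurable.of_discrete
  simpa only [serviceProb, Function.comp_def, Function.uncurry] using h3.comp (h1.prodMk h2)

theorem tied_pos (β : Fin n → ℝ) (i : Fin n) :
    0 < (Finset.univ.filter fun j => β j = β i).card :=
  Finset.card_pos.2 ⟨i, by simp⟩

theorem le_serviceProb {β : Fin n → ℝ} {i : Fin n} {c : ℝ}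
    (h : ∀ l < (Finset.univ.filter fun j => β j = β i).card,
      c ≤ weightAt w ((Finset.univ.filter fun j => β i < β j).card + l)) :
    c ≤ serviceProb w β i := by
  have hpos : (0 : ℝ) < (Finset.univ.filter fun j => β j = β i).card :=
    Nat.cast_pos.2 (tied_pos β i)
  rw [serviceProb, le_div_iff₀ hpos, mul_comm, ← nsmul_eq_mul]
  simpa using Finset.card_nsmul_le_sum (Finset.range _) _ c fun l hl => h l (Finset.mem_range.1 hl)

theorem serviceProb_le {β : Fin n → ℝ} {i : Fin n} {c : ℝ}
    (h : ∀ l < (Finset.univ.filter fun j => β j = β i).card,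
      weightAt w ((Finset.univ.filter fun j => β i < β j).card + l) ≤ c) :
    serviceProb w β i ≤ c := by
  have hpos : (0 : ℝ) < (Finset.univ.filter fun j => β j = β i).card :=
    Nat.cast_pos.2 (tied_pos β i)
  rw [serviceProb, div_le_iff₀ hpos, mul_comm, ← nsmul_eq_mul]
  simpa using Finset.sum_le_card_nsmul (Finset.range _) _ c fun l hl => h l (Finset.mem_range.1 hl)

theorem IsPositionWeights.serviceProb_nonneg (hw : IsPositionWeights w) (β : Fin n → ℝ)
    (i : Fin n) : 0 ≤ serviceProb w β i :=
  le_serviceProb fun _ _ => hw.weightAt_nonneg _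

theorem IsPositionWeights.serviceProb_le_one (hw : IsPositionWeights w) (β : Fin n → ℝ)
    (i : Fin n) : serviceProb w β i ≤ 1 :=
  serviceProb_le fun _ _ => hw.weightAt_le_one _

theorem card_above_add_card_tied_le (β : Fin n → ℝ) (i : Fin n) :
    (Finset.univ.filter fun j => β i < β j).card +
      (Finset.univ.filter fun j => β j = β i).card ≤ n := by
  rw [← Finset.card_union_of_disjoint]
  · simpa using Finset.card_le_univ
      ((Finset.univ.filter fun j => β i < β j) ∪ Finset.univ.filter fun j => β j = β i)
  · rw [Finset.disjoint_filter]
    exact fun j _ h => h.ne'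

theorem serviceProb_of_const {c : ℝ} (hc : ∀ i, w i = c) (β : Fin n → ℝ) (i : Fin n) :
    serviceProb w β i = c := by
  have h : ∀ l < (Finset.univ.filter fun j => β j = β i).card,
      weightAt w ((Finset.univ.filter fun j => β i < β j).card + l) = c := by
    intro l hl
    have := card_above_add_card_tied_le β i
    rw [weightAt, dif_pos (by omega), hc]
  exact le_antisymm (serviceProb_le fun l hl => (h l hl).le) (le_serviceProb fun l hl => (h l hl).ge)

theorem serviceProb_of_forall_ne {β : Fin n → ℝ} {i : Fin n} (h : ∀ j, j ≠ i → β j ≠ β i) :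
    serviceProb w β i = weightAt w (Finset.univ.filter fun j => β i < β j).card := by
  have h1 : (Finset.univ.filter fun j => β j = β i) = {i} := by
    ext j
    simp only [Finset.mem_filter, Finset.mem_univ, true_and, Finset.mem_singleton]
    exact ⟨fun hj => by_contra fun hne => h j hne hj, fun hj => hj ▸ rfl⟩
  rw [serviceProb, h1]
  simp

theorem serviceProb_of_forall_eq {β : Fin n → ℝ} {i : Fin n} (h : ∀ j, β j = β i) :
    serviceProb w β i = (∑ l ∈ Finset.range n, weightAt w l) / n := by
  have h1 : (Finset.univ.filter fun j => β j = β i) = Finset.univ :=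
    Finset.filter_true_of_mem fun j _ => h j
  have h2 : (Finset.univ.filter fun j => β i < β j) = ∅ :=
    Finset.filter_false_of_mem fun j _ => (h j).le.not_gt
  rw [serviceProb, h1, h2]
  simp

/-- Raising one's bid does not decrease the service probability. -/
theorem IsPositionWeights.serviceProb_update_le (hw : IsPositionWeights w) (β : Fin n → ℝ)
    (i : Fin n) {z z' : ℝ} (hz : z < z') :
    serviceProb w (Function.update β i z) i ≤ serviceProb w (Function.update β i z') i := by
  set b := Function.update β i z
  set b' := Function.update β i z'
  have hbi : b i = z := Function.update_self ..
  have hbi' : b' i = z' := Function.update_self ..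
  have hb : ∀ j, j ≠ i → b j = b' j := fun j hj => by simp [b, b', Function.update_of_ne hj]
  have hle : serviceProb w b i ≤ weightAt w (Finset.univ.filter fun j => b i < b j).card :=
    serviceProb_le fun l _ => hw.antitone_weightAt (Nat.le_add_right _ _)
  refine hle.trans (le_serviceProb fun l hl => hw.antitone_weightAt ?_)
  -- Every opponent who is above or tied at the higher bid is strictly above the lower one. So even
  -- the worst position of the tie at `z'` is no worse than the best position at `z`.
  have hcard : (Finset.univ.filter fun j => b' i < b' j).card +
      (Finset.univ.filter fun j => b' j = b' i).card ≤
        (insert i (Finset.univ.filter fun j => b i < b j)).card := by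
    rw [← Finset.card_union_of_disjoint]
    · apply Finset.card_le_card
      intro j hj
      by_cases hji : j = i
      · simp [hji]
      · simp only [Finset.mem_union, Finset.mem_filter, Finset.mem_univ, true_and,
          hbi'] at hj
        simp only [Finset.mem_insert, Finset.mem_filter, Finset.mem_univ, true_and, hbi]
        rw [hb j hji]
        exact Or.inr (hj.elim (hz.trans ·) (fun h => h ▸ hz))
    · rw [Finset.disjoint_filter]
      exact fun j _ h => h.ne'
  have := Finset.card_insert_le i (Finset.univ.filter fun j => b i < b j)
  omega

end Service

/-! ### Interim allocation -/

/-- The payment corresponding to the bid `z` and the service probability `a`. -/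
def bidPayment (fmt : PaymentFormat) (z a : ℝ) : ℝ :=
  match fmt with
  | .firstPrice => z * a
  | .allPay => z

theorem payment_eq_bidPayment (fmt : PaymentFormat) {n : ℕ} (w β : Fin n → ℝ) (i : Fin n) :
    payment fmt w β i = bidPayment fmt (β i) (serviceProb w β i) := by
  cases fmt <;> rfl

/-- The service probability of agent `i` with bid `z` when the others bid by the strategy `s`. -/
noncomputable def interimAlloc {n : ℕ} (w : Fin n → ℝ) (F : Measure ℝ) (s : ℝ → ℝ) (i : Fin n)
    (z : ℝ) : ℝ :=
  ∫ v, serviceProb w (deviate s v i z) i ∂(Measure.pi fun _ : Fin n => F)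

section Interim

variable {n : ℕ} {w : Fin n → ℝ} {F : Measure ℝ} [IsProbabilityMeasure F] {s : ℝ → ℝ}

theorem measurable_deviate (hs : Measurable s) (i : Fin n) (z : ℝ) :
    Measurable fun v : Fin n → ℝ => deviate s v i z := by
  rw [measurable_pi_iff]
  intro j
  by_cases hj : j = i
  · subst hj
    simp [deviate]
  · simp only [deviate, Function.update_of_ne hj]
    exact hs.comp (measurable_pi_apply j)

theorem deviate_self (s : ℝ → ℝ) (v : Fin n → ℝ) (i : Fin n) (z : ℝ) : deviate s v i z i = z :=
  Function.update_self ..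

theorem IsPositionWeights.integrable_serviceProb (hw : IsPositionWeights w) (hs : Measurable s)
    (i : Fin n) (z : ℝ) :
    Integrable (fun v : Fin n → ℝ => serviceProb w (deviate s v i z) i)
      (Measure.pi fun _ : Fin n => F) := by
  refine Integrable.of_bound (C := 1)
    ((measurable_serviceProb w i).comp (measurable_deviate hs i z)).aestronglyMeasurable
    (ae_of_all _ fun v => ?_)
  rw [Real.norm_of_nonneg (hw.serviceProb_nonneg _ _)]
  exact hw.serviceProb_le_one _ _

theorem interimUtility_eq (fmt : PaymentFormat) (w : Fin n → ℝ) (s : ℝ → ℝ) (i : Fin n)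
    (x z : ℝ) : interimUtility fmt w F s i x z =
      x * interimAlloc w F s i z - bidPayment fmt z (interimAlloc w F s i z) := by
  cases fmt
  · simp only [interimUtility, payment, deviate_self, integral_const_mul]
    rfl
  · simp [interimUtility, payment, deviate_self, bidPayment, interimAlloc]

omit [IsProbabilityMeasure F] in
theorem IsPositionWeights.interimAlloc_nonneg (hw : IsPositionWeights w) (i : Fin n) (z : ℝ) :
    0 ≤ interimAlloc w F s i z :=
  integral_nonneg fun _ => hw.serviceProb_nonneg _ _

theorem IsPositionWeights.interimAlloc_le_one (hw : IsPositionWeights w) (hs : Measurable s)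
    (i : Fin n) (z : ℝ) : interimAlloc w F s i z ≤ 1 := by
  have := integral_mono (hw.integrable_serviceProb (F := F) hs i z) (integrable_const 1)
    fun v => hw.serviceProb_le_one _ _
  rw [interimAlloc]
  simpa using this

/-- Without ties, the interim allocation is the allocation rule at the quantile of the bid. -/
theorem interimAlloc_eq_alloc (w : Fin n → ℝ) (hs : Measurable s) (i : Fin n) {z : ℝ}
    (hz : F {x | s x = z} = 0) : interimAlloc w F s i z = alloc w (F.real {x | s x ≤ z}) := by
  classical
  have hA : MeasurableSet {x | z < s x} := measurableSet_lt measurable_const hs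
  have hae : ∀ᵐ v ∂(Measure.pi fun _ : Fin n => F), serviceProb w (deviate s v i z) i =
      weightAt w ((Finset.univ.erase i).filter fun j => v j ∈ {x | z < s x}).card := by
    have h1 : ∀ᵐ v ∂(Measure.pi fun _ : Fin n => F), ∀ j, s (v j) ≠ z := by
      rw [ae_all_iff]
      intro j
      exact (Measure.quasiMeasurePreserving_eval (fun _ : Fin n => F) j).ae
        (measure_eq_zero_iff_ae_notMem.1 hz)
    filter_upwards [h1] with v hv
    rw [serviceProb_of_forall_ne]
    · congr 2
      ext j
      by_cases hj : j = i
      · simp [hj]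
      · simp [hj, deviate]
    · intro j hj
      rw [deviate_self, deviate, Function.update_of_ne hj]
      exact hv j
  have hn : n - 1 + 1 = n := Nat.sub_add_cancel i.pos
  rw [interimAlloc, integral_congr_ae hae,
    integral_card_filter_mem hA (Finset.univ.erase i) (weightAt w), alloc_eq_sum_bern,
    Finset.card_erase_of_mem (Finset.mem_univ i), Finset.card_univ, Fintype.card_fin, hn]
  have hcompl : {x | s x ≤ z} = {x | z < s x}ᶜ := by ext; simp
  rw [hcompl, probReal_compl_eq_one_sub hA]
  refine Finset.sum_congr rfl fun m _ => ?_
  rw [bern, sub_sub_cancel]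

/-- The average is the service in a tie of all agents, the top weight the service after overbidding
that tie; the strict gap is what rules out atoms. -/
theorem IsPositionWeights.average_lt (hw : IsPositionWeights w) {i j : Fin n} (hij : w i ≠ w j) :
    (∑ l ∈ Finset.range n, weightAt w l) / n < weightAt w 0 := by
  have hn : (0 : ℝ) < n := Nat.cast_pos.2 i.pos
  rw [div_lt_iff₀ hn, mul_comm]
  have hle : ∀ l ∈ Finset.range n, weightAt w l ≤ weightAt w 0 :=
    fun l _ => hw.antitone_weightAt (Nat.zero_le l)
  have hlt : ∃ l ∈ Finset.range n, weightAt w l < weightAt w 0 := by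
    by_contra! h
    apply hij
    rw [← weightAt_coe w, ← weightAt_coe w]
    have hi := Finset.mem_range.2 i.2
    have hj := Finset.mem_range.2 j.2
    rw [le_antisymm (hle _ hi) (h _ hi), le_antisymm (hle _ hj) (h _ hj)]
  simpa using Finset.sum_lt_sum hle hlt

theorem IsPositionWeights.average_pos (hw : IsPositionWeights w) {i j : Fin n} (hij : w i ≠ w j) :
    0 < (∑ l ∈ Finset.range n, weightAt w l) / n := by
  have hn : (0 : ℝ) < n := Nat.cast_pos.2 i.pos
  refine div_pos (Finset.sum_pos' (fun l _ => hw.weightAt_nonneg l)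
    ⟨0, Finset.mem_range.2 i.pos, ?_⟩) hn
  exact (div_nonneg (Finset.sum_nonneg fun l _ => hw.weightAt_nonneg l) hn.le).trans_lt
    (hw.average_lt hij)

theorem pi_measureReal_forall_eq (z : ℝ) :
    (Measure.pi fun _ : Fin n => F).real (Set.univ.pi fun _ => {x | s x = z}) =
      F.real {x | s x = z} ^ n := by
  simp [measureReal_def, Measure.pi_pi, ENNReal.toReal_pow]

theorem measurableSet_univ_pi_eq (hs : Measurable s) (z : ℝ) :
    MeasurableSet (Set.univ.pi fun _ : Fin n => {x | s x = z}) :=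
  MeasurableSet.univ_pi fun _ => measurableSet_eq_fun hs measurable_const

/-- Only the event that all drawn values lead to the bid `z` is counted. It includes the immaterial
draw of agent `i`, hence the exponent `n` and not `n - 1`; only positivity matters later. -/
theorem IsPositionWeights.average_mul_le_interimAlloc (hw : IsPositionWeights w)
    (hs : Measurable s) (i : Fin n) (z : ℝ) :
    (∑ l ∈ Finset.range n, weightAt w l) / n * F.real {x | s x = z} ^ n ≤
      interimAlloc w F s i z := by
  have hE := measurableSet_univ_pi_eq (n := n) hs z
  rw [← pi_measureReal_forall_eq, mul_comm, ← smul_eq_mul, ← integral_indicator_const _ hE]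
  refine integral_mono ((integrable_const _).indicator hE)
    (hw.integrable_serviceProb hs i z) fun v => ?_
  by_cases hv : v ∈ Set.univ.pi fun _ : Fin n => {x | s x = z}
  · rw [Set.indicator_of_mem hv]
    refine (serviceProb_of_forall_eq fun j => ?_).ge
    rw [deviate_self]
    by_cases hj : j = i
    · rw [hj, deviate_self]
    · rw [deviate, Function.update_of_ne hj]
      exact hv j (Set.mem_univ j)
  · rw [Set.indicator_of_notMem hv]
    exact hw.serviceProb_nonneg _ _

/-- Overbidding an atom of the bid distribution yields a discrete gain. -/
theorem IsPositionWeights.interimAlloc_add_le (hw : IsPositionWeights w)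
    (hs : Measurable s) (i : Fin n) {z z' : ℝ} (hz : z < z') :
    interimAlloc w F s i z + (weightAt w 0 - (∑ l ∈ Finset.range n, weightAt w l) / n) *
      F.real {x | s x = z} ^ n ≤ interimAlloc w F s i z' := by
  have hE := measurableSet_univ_pi_eq (n := n) hs z
  rw [← pi_measureReal_forall_eq, mul_comm, ← smul_eq_mul, ← integral_indicator_const _ hE,
    interimAlloc, ← integral_add (hw.integrable_serviceProb hs i z)
      ((integrable_const _).indicator hE)]
  refine integral_mono ((hw.integrable_serviceProb hs i z).add
    ((integrable_const _).indicator hE)) (hw.integrable_serviceProb hs i z') fun v => ?_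
  by_cases hv : v ∈ Set.univ.pi fun _ : Fin n => {x | s x = z}
  · have h1 : serviceProb w (deviate s v i z) i = (∑ l ∈ Finset.range n, weightAt w l) / n := by
      refine serviceProb_of_forall_eq fun j => ?_
      rw [deviate_self]
      by_cases hj : j = i
      · rw [hj, deviate_self]
      · rw [deviate, Function.update_of_ne hj]
        exact hv j (Set.mem_univ j)
    have hne : ∀ j, j ≠ i → deviate s v i z' j = z := fun j hj => by
      rw [deviate, Function.update_of_ne hj]
      exact hv j (Set.mem_univ j)
    have h2 : serviceProb w (deviate s v i z') i = weightAt w 0 := by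
      rw [serviceProb_of_forall_ne fun j hj => by rw [hne j hj, deviate_self]; exact hz.ne]
      congr 1
      rw [Finset.card_eq_zero, Finset.filter_eq_empty_iff]
      intro j _
      rw [deviate_self]
      by_cases hj : j = i
      · rw [hj, deviate_self]; exact lt_irrefl _
      · rw [hne j hj]; exact hz.not_gt
    beta_reduce
    rw [Set.indicator_of_mem hv, h1, h2]
    exact (add_sub_cancel _ _).le
  · beta_reduce
    rw [Set.indicator_of_notMem hv, add_zero]
    exact hw.serviceProb_update_le _ i hz

end Interim

/-! ### Symmetric equilibria -/

section Equilibrium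

variable {fmt : PaymentFormat} {n : ℕ} {w : Fin n → ℝ} {F : Measure ℝ} [IsProbabilityMeasure F]
  {s : ℝ → ℝ}

theorem IsSymmetricBNE.le_utility (h : IsSymmetricBNE fmt w F s) (i : Fin n) {x : ℝ}
    (hx : x ∈ Set.Icc (0 : ℝ) 1) {z : ℝ} (hz : 0 ≤ z) :
    x * interimAlloc w F s i z - bidPayment fmt z (interimAlloc w F s i z) ≤
      x * interimAlloc w F s i (s x) - bidPayment fmt (s x) (interimAlloc w F s i (s x)) := by
  rw [← interimUtility_eq, ← interimUtility_eq]
  exact h.bestResponse i x hx z hz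

/-- Unless all position weights agree, the equilibrium bids have no atoms. -/
theorem IsSymmetricBNE.measure_bid_eq (h : IsSymmetricBNE fmt w F s) (hw : IsPositionWeights w)
    [NullSingletonClass F] (hF : F (Set.Icc 0 1) = 1) {i j : Fin n} (hij : w i ≠ w j) (z : ℝ) :
    F {x | s x = z} = 0 := by
  by_contra hne
  have hp : 0 < F.real {x | s x = z} := ENNReal.toReal_pos hne (measure_ne_top _ _)
  -- Excluding two null values leaves a bidder at the atom who values service (`x ≠ 0`) and, in the
  -- first-price format, has a nonzero margin (`x ≠ z`).
  obtain ⟨x, hsx, hx, hx0, hxz⟩ : ∃ x, s x = z ∧ x ∈ Set.Icc (0 : ℝ) 1 ∧ x ≠ 0 ∧ x ≠ z := by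
    by_contra! hcon
    apply hne
    rw [measure_eq_zero_iff_ae_notMem]
    have h0 : ∀ a, ∀ᵐ x ∂F, x ≠ a := fun a =>
      measure_eq_zero_iff_ae_notMem.1 (measure_singleton (μ := F) a)
    filter_upwards [ae_mem_Icc_of_measure_eq_one hF, h0 0, h0 z] with x hx hx0 hxz hsx
    exact hxz (hcon x hsx hx hx0)
  have hz : 0 ≤ z := hsx ▸ h.nonneg x
  have hxpos : 0 < x := lt_of_le_of_ne hx.1 hx0.symm
  have hXpos := (mul_pos (hw.average_pos hij) (pow_pos hp n)).trans_le
    (hw.average_mul_le_interimAlloc h.measurable i z)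
  set δ := (weightAt w 0 - (∑ l ∈ Finset.range n, weightAt w l) / n) * F.real {x | s x = z} ^ n
    with hδ
  have hδpos : 0 < δ := mul_pos (sub_pos.2 (hw.average_lt hij)) (pow_pos hp n)
  have hgap : ∀ z', z < z' → interimAlloc w F s i z + δ ≤ interimAlloc w F s i z' :=
    fun z' hz' => hw.interimAlloc_add_le h.measurable i hz'
  have hle := hw.interimAlloc_le_one (F := F) h.measurable i
  cases fmt with
  | allPay =>
    -- Overbidding by half the value of the extra service is a profitable deviation.
    have hη : 0 < x * δ / 2 := by positivity
    have h1 := h.le_utility i hx (z := z + x * δ / 2) (by positivity)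
    have h2 := mul_le_mul_of_nonneg_left (hgap (z + x * δ / 2) (by linarith)) hxpos.le
    simp only [hsx, bidPayment] at h1
    nlinarith
  | firstPrice =>
    have h0 := h.le_utility i hx (z := 0) le_rfl
    simp only [hsx, bidPayment, zero_mul, sub_zero, ← sub_mul] at h0
    -- Bidding zero secures nonnegative utility, so the margin at the atom cannot be negative,
    -- because the service there is positive.
    have hd : 0 < x - z := by
      refine lt_of_le_of_ne ?_ (sub_ne_zero.2 hxz).symm
      exact nonneg_of_mul_nonneg_left
        ((mul_nonneg hxpos.le (hw.interimAlloc_nonneg i 0)).trans h0) hXpos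
    -- The extra service is worth `(x - z) * δ`. Since service probabilities are at most one, the
    -- raise costs at most half of that.
    have hη : 0 < (x - z) * δ / 2 := by positivity
    have h1 := h.le_utility i hx (z := z + (x - z) * δ / 2) (by positivity)
    have h2 := hgap (z + (x - z) * δ / 2) (by linarith)
    have h3 := hle (z + (x - z) * δ / 2)
    simp only [hsx, bidPayment, ← sub_mul] at h1
    have hδ1 : δ ≤ 1 := by linarith
    have h4 : 0 ≤ x - (z + (x - z) * δ / 2) := by nlinarith
    have h5 := mul_le_mul_of_nonneg_left h2 h4
    have h6 : (x - z) * δ / 2 * (interimAlloc w F s i z + δ) ≤ (x - z) * δ / 2 * 1 :=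
      mul_le_mul_of_nonneg_left (h2.trans h3) hη.le
    nlinarith

/-- In equilibrium the interim allocation is the allocation rule at the quantile of the value. -/
theorem IsSymmetricBNE.interimAlloc_eq (h : IsSymmetricBNE fmt w F s) (hw : IsPositionWeights w)
    [NullSingletonClass F] (hF : F (Set.Icc 0 1) = 1) {i j : Fin n} (hij : w i ≠ w j) {x : ℝ}
    (hx : x ∈ Set.Icc (0 : ℝ) 1) : interimAlloc w F s i (s x) = alloc w (cdf F x) := by
  have hs := h.measurable
  have hnull := h.measure_bid_eq hw hF hij
  have hG : IsProbabilityMeasure (F.map s) := Measure.isProbabilityMeasure_map hs.aemeasurable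
  have hGnull : NullSingletonClass (F.map s) := ⟨fun z => by
    rw [Measure.map_apply hs (measurableSet_singleton z)]
    exact hnull z⟩
  have hcdf : ∀ z, cdf (F.map s) z = F.real {x | s x ≤ z} := fun z => by
    rw [cdf_eq_real, map_measureReal_apply hs measurableSet_Iic]
    rfl
  have hX : ∀ z, interimAlloc w F s i z = alloc w (cdf (F.map s) z) := fun z => by
    rw [hcdf]
    exact interimAlloc_eq_alloc w hs i (hnull z)
  -- Adding the two incentive constraints between `a` and `b` shows that service is monotone in the
  -- value; strict monotonicity of `alloc` transfers this to bid quantiles.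
  have hmono : ∀ a ∈ Set.Icc (0 : ℝ) 1, ∀ b ∈ Set.Icc (0 : ℝ) 1, a < b →
      cdf (F.map s) (s a) ≤ cdf (F.map s) (s b) := by
    intro a ha b hb hab
    rw [← (hw.strictMonoOn_alloc hij).le_iff_le (cdf_mem_Icc _) (cdf_mem_Icc _), ← hX, ← hX]
    have h1 := h.le_utility i ha (h.nonneg b)
    have h2 := h.le_utility i hb (h.nonneg a)
    nlinarith
  have hmeas : Measurable (cdf (F.map s)) := (monotone_cdf _).measurable
  have hae := ae_mem_Icc_of_measure_eq_one hF
  rw [hX]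
  congr 1
  -- Up to null sets, `Iic x` lies between the values whose bid quantile is strictly below, and
  -- those whose bid quantile is at most, that of `s x`. Both have mass equal to that bid quantile.
  apply le_antisymm
  · rw [← measureReal_setOf_cdf_lt, map_measureReal_apply hs
      (measurableSet_lt hmeas measurable_const), cdf_eq_real F]
    refine ENNReal.toReal_mono (measure_ne_top F _) (measure_mono_ae ?_)
    filter_upwards [hae] with x' hx' hlt
    exact le_of_not_gt fun hgt => (hmono x hx x' hx' hgt).not_gt hlt
  · rw [← measureReal_setOf_cdf_le (F.map s), map_measureReal_apply hs
      (measurableSet_le hmeas measurable_const), cdf_eq_real F]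
    refine ENNReal.toReal_mono (measure_ne_top F _) (measure_mono_ae ?_)
    filter_upwards [hae] with x' hx' hle
    rcases (show x' ≤ x from hle).eq_or_lt with rfl | hlt
    · exact le_rfl (a := cdf (F.map s) (s x'))
    · exact hmono x' hx' x hx hlt

end Equilibrium

/-! ### Payments in quantile space -/

/-- Integration by parts against a primitive of an integrable function. -/
theorem integral_deriv_mul_primitive {f g : ℝ → ℝ}
    (hf : ∀ q ∈ Set.Icc (0 : ℝ) 1, ContDiffAt ℝ 1 f q) (hf1 : f 1 = 0)
    (hg : IntervalIntegrable g volume 0 1) :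
    ∫ q in (0 : ℝ)..1, deriv f q * ∫ r in (0 : ℝ)..q, g r = -∫ q in (0 : ℝ)..1, f q * g q := by
  -- As `g` is merely integrable, its primitive is absolutely continuous with derivative `g` only
  -- almost everywhere, so the absolutely continuous form of integration by parts is needed.
  have hfac : AbsolutelyContinuousOnInterval f 0 1 := by
    apply ContDiffOn.absolutelyContinuousOnInterval
    rw [Set.uIcc_of_le zero_le_one]
    exact fun q hq => (hf q hq).contDiffWithinAt
  have hgac := hg.absolutelyContinuousOnInterval_intervalIntegral (c := 0) (by simp)
  have h := hfac.integral_mul_deriv_eq_deriv_mul hgac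
  rw [hf1, intervalIntegral.integral_same] at h
  have h2 : ∫ q in (0 : ℝ)..1, f q * deriv (fun x => ∫ r in (0 : ℝ)..x, g r) q =
      ∫ q in (0 : ℝ)..1, f q * g q := by
    apply intervalIntegral.integral_congr_ae
    filter_upwards [hg.ae_hasDerivAt_integral] with q hq hq'
    rw [(hq (Set.uIoc_subset_uIcc hq') 0 (by simp)).deriv]
  rw [← h2, h]
  ring

/-- Continuity of `ξ` makes the difference quotients of `D` tend to zero, so `D` is constant. This
is the envelope argument without any regularity assumed of the bids. -/
theorem eq_of_abs_sub_le_mul_sub {D ξ : ℝ → ℝ} (hξ : Continuous ξ)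
    (h : ∀ x ∈ Set.Icc (0 : ℝ) 1, ∀ y ∈ Set.Icc (0 : ℝ) 1, x ≤ y →
      |D y - D x| ≤ (y - x) * (ξ y - ξ x)) {x : ℝ} (hx : x ∈ Set.Icc (0 : ℝ) 1) : D x = D 0 := by
  have h' : ∀ x ∈ Set.Icc (0 : ℝ) 1, ∀ y ∈ Set.Icc (0 : ℝ) 1,
      |D y - D x| ≤ |y - x| * |ξ y - ξ x| := by
    intro x hx y hy
    rw [← abs_mul]
    rcases le_total x y with hxy | hxy
    · exact (h x hx y hy hxy).trans (le_abs_self _)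
    · rw [abs_sub_comm (D y)]
      refine (h y hy x hx hxy).trans ?_
      rw [← neg_sub y x, ← neg_sub (ξ y), neg_mul_neg]
      exact le_abs_self _
  have hder : ∀ x ∈ Set.Icc (0 : ℝ) 1, HasDerivWithinAt D 0 (Set.Icc 0 1) x := by
    intro x hx
    rw [hasDerivWithinAt_iff_isLittleO, Asymptotics.isLittleO_iff]
    intro c hc
    have h1 : ∀ᶠ y in nhds x, |ξ y - ξ x| < c := Metric.tendsto_nhds.1 (hξ.tendsto x) c hc
    filter_upwards [nhdsWithin_le_nhds h1, self_mem_nhdsWithin] with y hy hyI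
    rw [smul_zero, sub_zero, Real.norm_eq_abs, Real.norm_eq_abs, mul_comm]
    exact (h' x hx y hyI).trans (mul_le_mul_of_nonneg_left hy.le (abs_nonneg _))
  have := (convex_Icc (0 : ℝ) 1).norm_image_sub_le_of_norm_hasDerivWithin_le hder
    (C := 0) (fun _ _ => by simp) ⟨le_rfl, zero_le_one⟩ hx
  rw [zero_mul, norm_le_zero_iff, sub_eq_zero] at this
  exact this

/-- The equilibrium payment `∫_0^q v(r) x'(r) dr` of an agent with quantile `q`. -/
noncomputable def quantilePayment (F : Measure ℝ) {n : ℕ} (w : Fin n → ℝ) (q : ℝ) : ℝ :=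
  ∫ r in (0 : ℝ)..q, quantileValue F r * deriv (alloc w) r

section Payment

variable {n : ℕ} {w : Fin n → ℝ} {F : Measure ℝ} [IsProbabilityMeasure F]

theorem quantilePayment_zero (F : Measure ℝ) (w : Fin n → ℝ) : quantilePayment F w 0 = 0 :=
  intervalIntegral.integral_same

theorem intervalIntegrable_quantilePayment (hF : F (Set.Icc 0 1) = 1) (hc : Continuous (cdf F))
    (w : Fin n → ℝ) :
    IntervalIntegrable (fun r => quantileValue F r * deriv (alloc w) r) volume 0 1 :=
  (intervalIntegrable_quantileValue hF hc).mul_continuousOn (continuous_deriv_alloc w).continuousOn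

theorem intervalIntegrable_quantilePayment_of_mem (hF : F (Set.Icc 0 1) = 1)
    (hc : Continuous (cdf F)) (w : Fin n → ℝ) {p q : ℝ} (hp : p ∈ Set.Icc (0 : ℝ) 1)
    (hq : q ∈ Set.Icc (0 : ℝ) 1) :
    IntervalIntegrable (fun r => quantileValue F r * deriv (alloc w) r) volume p q := by
  refine (intervalIntegrable_quantilePayment hF hc w).mono_set ?_
  rw [Set.uIcc_of_le zero_le_one]
  exact Set.uIcc_subset_Icc hp hq

theorem quantilePayment_sub (hF : F (Set.Icc 0 1) = 1) (hc : Continuous (cdf F)) (w : Fin n → ℝ)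
    {p q : ℝ} (hp : p ∈ Set.Icc (0 : ℝ) 1) (hq : q ∈ Set.Icc (0 : ℝ) 1) :
    quantilePayment F w q - quantilePayment F w p =
      ∫ r in p..q, quantileValue F r * deriv (alloc w) r :=
  intervalIntegral.integral_interval_sub_left
    (intervalIntegrable_quantilePayment_of_mem hF hc w ⟨le_rfl, zero_le_one⟩ hq)
    (intervalIntegrable_quantilePayment_of_mem hF hc w ⟨le_rfl, zero_le_one⟩ hp)

theorem integral_const_mul_deriv_alloc (w : Fin n → ℝ) (b p q : ℝ) :
    ∫ r in p..q, b * deriv (alloc w) r = b * (alloc w q - alloc w p) := by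
  rw [intervalIntegral.integral_const_mul, intervalIntegral.integral_deriv_eq_sub
    (fun r _ => differentiable_alloc w r) ((continuous_deriv_alloc w).intervalIntegrable p q)]

theorem quantilePayment_sub_le (hw : IsPositionWeights w) (hF : F (Set.Icc 0 1) = 1)
    (hc : Continuous (cdf F)) {p q : ℝ} (hp : p ∈ Set.Icc (0 : ℝ) 1) (hq : q ∈ Set.Icc (0 : ℝ) 1)
    (hpq : p ≤ q) {b : ℝ} (hb : ∀ r ∈ Set.Ioo p q, quantileValue F r ≤ b) :
    quantilePayment F w q - quantilePayment F w p ≤ b * (alloc w q - alloc w p) := by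
  rw [quantilePayment_sub hF hc w hp hq, ← integral_const_mul_deriv_alloc]
  refine intervalIntegral.integral_mono_on_of_le_Ioo hpq
    (intervalIntegrable_quantilePayment_of_mem hF hc w hp hq)
    ((continuous_const.mul (continuous_deriv_alloc w)).intervalIntegrable p q) fun r hr => ?_
  exact mul_le_mul_of_nonneg_right (hb r hr)
    (hw.deriv_alloc_nonneg ⟨hp.1.trans hr.1.le, hr.2.le.trans hq.2⟩)

theorem le_quantilePayment_sub (hw : IsPositionWeights w) (hF : F (Set.Icc 0 1) = 1)
    (hc : Continuous (cdf F)) {p q : ℝ} (hp : p ∈ Set.Icc (0 : ℝ) 1) (hq : q ∈ Set.Icc (0 : ℝ) 1)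
    (hpq : p ≤ q) {a : ℝ} (ha : ∀ r ∈ Set.Ioo p q, a ≤ quantileValue F r) :
    a * (alloc w q - alloc w p) ≤ quantilePayment F w q - quantilePayment F w p := by
  rw [quantilePayment_sub hF hc w hp hq, ← integral_const_mul_deriv_alloc]
  refine intervalIntegral.integral_mono_on_of_le_Ioo hpq
    ((continuous_const.mul (continuous_deriv_alloc w)).intervalIntegrable p q)
    (intervalIntegrable_quantilePayment_of_mem hF hc w hp hq) fun r hr => ?_
  exact mul_le_mul_of_nonneg_right (ha r hr)
    (hw.deriv_alloc_nonneg ⟨hp.1.trans hr.1.le, hr.2.le.trans hq.2⟩)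

/-- An agent with value `x` is charged at most `x` per unit for quantiles below her own. -/
theorem quantilePayment_cdf_sub_le (hw : IsPositionWeights w) (hF : F (Set.Icc 0 1) = 1)
    (hc : Continuous (cdf F)) {q x : ℝ} (hq : q ∈ Set.Icc (0 : ℝ) 1) (hqx : q ≤ cdf F x) :
    quantilePayment F w (cdf F x) - quantilePayment F w q ≤
      x * (alloc w (cdf F x) - alloc w q) :=
  quantilePayment_sub_le hw hF hc hq (cdf_mem_Icc x) hqx fun _ hr =>
    (quantileValue_le_iff hF hc ⟨hq.1.trans_lt hr.1, hr.2.le.trans (cdf_le_one F x)⟩).2 hr.2.le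

/-- An agent with value `x` is charged at least `x` per unit for quantiles above her own. -/
theorem le_quantilePayment_sub_cdf (hw : IsPositionWeights w) (hF : F (Set.Icc 0 1) = 1)
    (hc : Continuous (cdf F)) {q x : ℝ} (hq : q ∈ Set.Icc (0 : ℝ) 1) (hxq : cdf F x ≤ q) :
    x * (alloc w q - alloc w (cdf F x)) ≤
      quantilePayment F w q - quantilePayment F w (cdf F x) := by
  refine le_quantilePayment_sub hw hF hc (cdf_mem_Icc x) hq hxq fun r hr => ?_
  by_contra hlt
  exact hr.1.not_ge ((quantileValue_le_iff hF hc
    ⟨(cdf_nonneg F x).trans_lt hr.1, hr.2.le.trans hq.2⟩).1 (not_le.1 hlt).le)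

theorem quantilePayment_mono (hw : IsPositionWeights w) (hF : F (Set.Icc 0 1) = 1)
    (hc : Continuous (cdf F)) : MonotoneOn (quantilePayment F w) (Set.Icc 0 1) := by
  intro p hp q hq hpq
  have := le_quantilePayment_sub (w := w) hw hF hc hp hq hpq (a := 0) fun r hr =>
    (quantileValue_mem_Icc hF hc ⟨hp.1.trans hr.1.le, hr.2.le.trans hq.2⟩).1
  linarith

theorem quantilePayment_nonneg (hw : IsPositionWeights w) (hF : F (Set.Icc 0 1) = 1)
    (hc : Continuous (cdf F)) {q : ℝ} (hq : q ∈ Set.Icc (0 : ℝ) 1) : 0 ≤ quantilePayment F w q := by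
  rw [← quantilePayment_zero F w]
  exact quantilePayment_mono hw hF hc ⟨le_rfl, zero_le_one⟩ hq hq.1

theorem quantilePayment_le (hw : IsPositionWeights w) (hF : F (Set.Icc 0 1) = 1)
    (hc : Continuous (cdf F)) {q : ℝ} (hq : q ∈ Set.Icc (0 : ℝ) 1) :
    quantilePayment F w q ≤ quantileValue F q * (alloc w q - alloc w 0) := by
  have := quantilePayment_sub_le (w := w) hw hF hc ⟨le_rfl, zero_le_one⟩ hq hq.1
    fun r hr => monotoneOn_quantileValue hF hc ⟨hr.1.le, hr.2.le.trans hq.2⟩ hq hr.2.le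
  rwa [quantilePayment_zero, sub_zero] at this

theorem quantilePayment_le_alloc (hw : IsPositionWeights w) (hF : F (Set.Icc 0 1) = 1)
    (hc : Continuous (cdf F)) {q : ℝ} (hq : q ∈ Set.Icc (0 : ℝ) 1) :
    quantilePayment F w q ≤ alloc w q := by
  have h0 : (0 : ℝ) ∈ Set.Icc (0 : ℝ) 1 := ⟨le_rfl, zero_le_one⟩
  have h1 := hw.monotoneOn_alloc h0 hq hq.1
  have h2 := hw.alloc_nonneg h0
  have h3 := mul_le_of_le_one_left (sub_nonneg.2 h1) (quantileValue_mem_Icc hF hc hq).2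
  linarith [quantilePayment_le hw hF hc hq]

theorem continuousOn_quantilePayment (hF : F (Set.Icc 0 1) = 1) (hc : Continuous (cdf F))
    (w : Fin n → ℝ) : ContinuousOn (quantilePayment F w) (Set.Icc 0 1) := by
  have := intervalIntegral.continuousOn_primitive_interval' (a := 0)
    (intervalIntegrable_quantilePayment hF hc w) Set.left_mem_uIcc
  rwa [Set.uIcc_of_le zero_le_one] at this

theorem positionRevenue_eq_integral (hF : F (Set.Icc 0 1) = 1) (hc : Continuous (cdf F))
    (w : Fin n → ℝ) : positionRevenue F w =
      ∫ q in (0 : ℝ)..1, deriv (alloc w) q * revenueCurve F q := by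
  have hint : ∀ k : Fin n, IntervalIntegrable
      (fun q => marginalWeight w k * (deriv (unitAlloc n (k + 1)) q * revenueCurve F q))
      volume 0 1 := by
    intro k
    refine IntervalIntegrable.const_mul ?_ _
    unfold revenueCurve
    refine ((intervalIntegrable_quantileValue hF hc).mul_continuousOn
      (by fun_prop)).continuousOn_mul ?_
    rw [deriv_unitAlloc_succ]
    exact (continuous_const.mul (continuous_bern _ _)).continuousOn
  simp only [positionRevenue, multiUnitRevenue]
  simp_rw [← intervalIntegral.integral_const_mul]
  rw [← intervalIntegral.integral_finsetSum fun k _ => hint k]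
  refine intervalIntegral.integral_congr fun q _ => ?_
  simp only [deriv_alloc, deriv_unitAlloc_succ, Finset.sum_mul]
  exact Finset.sum_congr rfl fun k _ => by ring

/-- Integration by parts with `q - 1`, which vanishes at `1`, turns the mean payment into the
integral of `(1 - q) v x' = R x'`. -/
theorem integral_quantilePayment (hF : F (Set.Icc 0 1) = 1) (hc : Continuous (cdf F))
    (w : Fin n → ℝ) : ∫ q in (0 : ℝ)..1, quantilePayment F w q = positionRevenue F w := by
  have h := integral_deriv_mul_primitive (f := fun q => q - 1)
    (g := fun r => quantileValue F r * deriv (alloc w) r)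
    (fun q _ => contDiffAt_id.sub contDiffAt_const) (sub_self 1)
    (intervalIntegrable_quantilePayment hF hc w)
  have hd : ∀ q : ℝ, deriv (fun q : ℝ => q - 1) q = 1 := fun q =>
    ((hasDerivAt_id q).sub_const 1).deriv
  simp only [hd, one_mul] at h
  rw [positionRevenue_eq_integral hF hc]
  unfold quantilePayment
  rw [h, ← intervalIntegral.integral_neg]
  refine intervalIntegral.integral_congr fun q _ => ?_
  simp only [revenueCurve]
  ring

end Payment

/-! ### Revenue in equilibrium -/

section Revenue

variable {fmt : PaymentFormat} {n : ℕ} {w : Fin n → ℝ} {F : Measure ℝ} [IsProbabilityMeasure F]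
  {s : ℝ → ℝ}

theorem bidPayment_nonneg (fmt : PaymentFormat) {z a : ℝ} (hz : 0 ≤ z) (ha : 0 ≤ a) :
    0 ≤ bidPayment fmt z a := by
  cases fmt
  · exact mul_nonneg hz ha
  · exact hz

theorem bidPayment_zero (fmt : PaymentFormat) (a : ℝ) : bidPayment fmt 0 a = 0 := by
  cases fmt <;> simp [bidPayment]

theorem bidPayment_le (fmt : PaymentFormat) {z a : ℝ} (hz : 0 ≤ z) (ha : a ≤ 1) :
    bidPayment fmt z a ≤ z := by
  cases fmt
  · exact mul_le_of_le_one_right hz ha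
  · exact le_rfl

/-- Value zero gains nothing from service, so any positive payment is beaten by bidding zero. This
fixes the constant in the payment formula. -/
theorem IsSymmetricBNE.bidPayment_bid_zero (h : IsSymmetricBNE fmt w F s)
    (hw : IsPositionWeights w) (i : Fin n) :
    bidPayment fmt (s 0) (interimAlloc w F s i (s 0)) = 0 := by
  have h0 := h.le_utility i (x := 0) ⟨le_rfl, zero_le_one⟩ (z := 0) le_rfl
  rw [zero_mul, zero_mul, bidPayment_zero] at h0
  exact le_antisymm (by linarith) (bidPayment_nonneg fmt (h.nonneg 0) (hw.interimAlloc_nonneg i _))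

/-- The payments in equilibrium are determined by the allocation rule. -/
theorem IsSymmetricBNE.bidPayment_eq (h : IsSymmetricBNE fmt w F s) (hw : IsPositionWeights w)
    (hF : F (Set.Icc 0 1) = 1) (hc : Continuous (cdf F)) {i j : Fin n} (hij : w i ≠ w j) {x : ℝ}
    (hx : x ∈ Set.Icc (0 : ℝ) 1) :
    bidPayment fmt (s x) (alloc w (cdf F x)) = quantilePayment F w (cdf F x) := by
  have := nullSingletonClass_of_continuous_cdf F hc
  have h0 : (0 : ℝ) ∈ Set.Icc (0 : ℝ) 1 := ⟨le_rfl, zero_le_one⟩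
  have hX : ∀ x ∈ Set.Icc (0 : ℝ) 1, interimAlloc w F s i (s x) = alloc w (cdf F x) :=
    fun x hx => h.interimAlloc_eq hw hF hij hx
  -- For `x ≤ y`, incentive constraints place the increment of the payments between `x` and `y`
  -- times the increment of service. The increment of `quantilePayment` obeys the same bounds, so
  -- the difference of the two is controlled.
  have key := eq_of_abs_sub_le_mul_sub
    (D := fun x => bidPayment fmt (s x) (alloc w (cdf F x)) - quantilePayment F w (cdf F x))
    (ξ := fun x => alloc w (cdf F x)) ((continuous_alloc w).comp hc) (fun x hx y hy hxy => by
      have h1 := h.le_utility i hx (h.nonneg y)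
      have h2 := h.le_utility i hy (h.nonneg x)
      rw [hX x hx, hX y hy] at h1 h2
      have h3 := quantilePayment_cdf_sub_le hw hF hc (cdf_mem_Icc x) (monotone_cdf F hxy)
      have h4 := le_quantilePayment_sub_cdf hw hF hc (cdf_mem_Icc y) (monotone_cdf F hxy)
      rw [abs_le]
      constructor <;> linarith) hx
  have hpay0 := h.bidPayment_bid_zero hw i
  rw [hX 0 h0] at hpay0
  beta_reduce at key
  rw [hpay0, cdf_zero_of_measure_Icc hF, quantilePayment_zero, sub_zero] at key
  exact sub_eq_zero.1 key

theorem measurable_payment (fmt : PaymentFormat) (w : Fin n → ℝ) (hs : Measurable s) (i : Fin n) :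
    Measurable fun v : Fin n → ℝ => payment fmt w (fun j => s (v j)) i := by
  have h1 : Measurable fun v : Fin n → ℝ => s (v i) := hs.comp (measurable_pi_apply i)
  have h2 : Measurable fun v : Fin n → ℝ => fun j => s (v j) :=
    measurable_pi_iff.2 fun j => hs.comp (measurable_pi_apply j)
  cases fmt
  · exact h1.mul ((measurable_serviceProb w i).comp h2)
  · exact h1

theorem integrable_payment (fmt : PaymentFormat) (hw : IsPositionWeights w) (hs : Measurable s)
    (hs0 : ∀ x, 0 ≤ s x) (hs1 : ∀ᵐ x ∂F, s x ≤ 1) (i : Fin n) :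
    Integrable (fun v : Fin n → ℝ => payment fmt w (fun j => s (v j)) i)
      (Measure.pi fun _ : Fin n => F) := by
  refine Integrable.of_bound (C := 1) (measurable_payment fmt w hs i).aestronglyMeasurable ?_
  filter_upwards [(Measure.quasiMeasurePreserving_eval (fun _ : Fin n => F) i).ae hs1] with v hv
  rw [payment_eq_bidPayment, Real.norm_of_nonneg
    (bidPayment_nonneg fmt (hs0 _) (hw.serviceProb_nonneg _ _))]
  exact (bidPayment_le fmt (hs0 _) (hw.serviceProb_le_one _ _)).trans hv

/-- After resampling coordinate `i`, Fubini averages over the opponents first. The payment is affine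
in the service probability, which may thus be replaced by its mean. -/
theorem integral_payment (fmt : PaymentFormat) (hw : IsPositionWeights w) (hs : Measurable s)
    (hs0 : ∀ x, 0 ≤ s x) (hs1 : ∀ᵐ x ∂F, s x ≤ 1) (i : Fin n) :
    ∫ v, payment fmt w (fun j => s (v j)) i ∂(Measure.pi fun _ : Fin n => F) =
      ∫ x, bidPayment fmt (s x) (interimAlloc w F s i (s x)) ∂F := by
  have hint := integrable_payment (F := F) fmt hw hs hs0 hs1 i
  have hmp := measurePreserving_update (μ := F) i
  rw [← hmp.map_eq] at hint ⊢
  rw [integral_map hmp.measurable.aemeasurable hint.aestronglyMeasurable,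
    integral_prod (fun p : ℝ × (Fin n → ℝ) => payment fmt w
      (fun j => s (Function.update p.2 i p.1 j)) i) (hint.comp_measurable hmp.measurable)]
  refine integral_congr_ae (ae_of_all _ fun x => ?_)
  have hdev : ∀ v : Fin n → ℝ,
      (fun j => s (Function.update v i x j)) = deviate s v i (s x) := by
    intro v
    ext j
    by_cases hj : j = i
    · subst hj; simp [deviate]
    · simp [deviate, Function.update_of_ne hj]
  simp only [hdev, payment_eq_bidPayment, deviate_self]
  cases fmt
  · exact integral_const_mul _ _
  · simp [bidPayment]

/-- In the first-price format the payment controls the bid only where service is positive. Service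
may vanish at quantile zero, so the bound is almost sure. -/
theorem IsSymmetricBNE.ae_bid_le_one (h : IsSymmetricBNE fmt w F s) (hw : IsPositionWeights w)
    (hF : F (Set.Icc 0 1) = 1) (hc : Continuous (cdf F)) {i j : Fin n} (hij : w i ≠ w j) :
    ∀ᵐ x ∂F, s x ≤ 1 := by
  have := nullSingletonClass_of_continuous_cdf F hc
  have hne : ∀ᵐ x ∂F, cdf F x ≠ 0 :=
    measure_eq_zero_iff_ae_notMem.1 (measure_setOf_cdf_eq F 0)
  filter_upwards [ae_mem_Icc_of_measure_eq_one hF, hne] with x hx hx0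
  have hpay := h.bidPayment_eq hw hF hc hij hx
  have hmem := cdf_mem_Icc (μ := F) x
  have hle := quantilePayment_le_alloc (w := w) hw hF hc hmem
  cases fmt with
  | firstPrice =>
    have h0 : (0 : ℝ) ∈ Set.Icc (0 : ℝ) 1 := ⟨le_rfl, zero_le_one⟩
    have hpos := (hw.alloc_nonneg h0).trans_lt
      (hw.strictMonoOn_alloc hij h0 hmem (lt_of_le_of_ne hmem.1 hx0.symm))
    rw [← hpay] at hle
    exact (mul_le_iff_le_one_left hpos).1 hle
  | allPay => exact (hpay.le.trans hle).trans (hw.alloc_le_one hmem)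

/-- Revenue equivalence: the equilibrium revenue is `n` times the per-agent revenue in terms of
the multi-unit revenues. -/
theorem IsSymmetricBNE.expectedRevenue_eq (h : IsSymmetricBNE fmt w F s)
    (hw : IsPositionWeights w) (hF : F (Set.Icc 0 1) = 1) (hc : Continuous (cdf F))
    {i j : Fin n} (hij : w i ≠ w j) : expectedRevenue fmt w F s = n * positionRevenue F w := by
  have := nullSingletonClass_of_continuous_cdf F hc
  have hs1 := h.ae_bid_le_one hw hF hc hij
  rw [expectedRevenue, integral_finsetSum _ fun i _ =>
    integrable_payment fmt hw h.measurable h.nonneg hs1 i]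
  have hsum : ∀ k : Fin n, ∫ v, payment fmt w (fun j => s (v j)) k
      ∂(Measure.pi fun _ : Fin n => F) = positionRevenue F w := by
    intro k
    -- The equilibrium lemmas speak of the first agent of a pair with distinct weights, so each
    -- agent needs such a partner.
    obtain ⟨l, hkl⟩ : ∃ l, w k ≠ w l := by
      by_contra! hk
      exact hij (by rw [← hk i, ← hk j])
    rw [integral_payment fmt hw h.measurable h.nonneg hs1 k, ← integral_quantilePayment hF hc,
      intervalIntegral.integral_of_le zero_le_one, ← integral_Icc_eq_integral_Ioc,
      ← map_cdf_eq_restrict hF hc, integral_map hc.measurable.aemeasurable]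
    · refine integral_congr_ae ?_
      filter_upwards [ae_mem_Icc_of_measure_eq_one hF] with x hx
      rw [h.interimAlloc_eq hw hF hkl hx, h.bidPayment_eq hw hF hc hkl hx]
    · rw [map_cdf_eq_restrict hF hc]
      exact (continuousOn_quantilePayment hF hc w).aestronglyMeasurable measurableSet_Icc
  rw [Finset.sum_congr rfl fun k _ => hsum k]
  simp

theorem positionRevenue_nonneg (hw : IsPositionWeights w) (hF : F (Set.Icc 0 1) = 1)
    (hc : Continuous (cdf F)) : 0 ≤ positionRevenue F w := by
  rw [← integral_quantilePayment hF hc]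
  exact intervalIntegral.integral_nonneg zero_le_one fun q hq => quantilePayment_nonneg hw hF hc hq

/-- This covers competitors with constant weights as well, where atoms are possible: service then
ignores bids, bidding zero costs nothing, and so every equilibrium payment vanishes. -/
theorem IsSymmetricBNE.expectedRevenue_le (h : IsSymmetricBNE fmt w F s)
    (hw : IsPositionWeights w) (hF : F (Set.Icc 0 1) = 1) (hc : Continuous (cdf F)) :
    expectedRevenue fmt w F s ≤ n * positionRevenue F w := by
  by_cases hconst : ∃ i j, w i ≠ w j
  · obtain ⟨i, j, hij⟩ := hconst
    exact (h.expectedRevenue_eq hw hF hc hij).le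
  push Not at hconst
  refine le_trans (le_of_eq ?_) (mul_nonneg (Nat.cast_nonneg _) (positionRevenue_nonneg hw hF hc))
  refine integral_eq_zero_of_ae ?_
  have hae : ∀ᵐ v ∂(Measure.pi fun _ : Fin n => F), ∀ i, v i ∈ Set.Icc (0 : ℝ) 1 :=
    ae_all_iff.2 fun i => (Measure.quasiMeasurePreserving_eval (fun _ : Fin n => F) i).ae
      (ae_mem_Icc_of_measure_eq_one hF)
  filter_upwards [hae] with v hv
  refine Finset.sum_eq_zero fun i _ => ?_
  have hserv : ∀ β, serviceProb w β i = w i := fun β => serviceProb_of_const (fun j => hconst j i) β i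
  have hX : ∀ z, interimAlloc w F s i z = w i := fun z => by
    simp [interimAlloc, hserv]
  have h1 := h.le_utility i (hv i) (z := 0) le_rfl
  rw [hX, hX, bidPayment_zero] at h1
  rw [payment_eq_bidPayment, hserv]
  exact le_antisymm (by linarith) (bidPayment_nonneg fmt (h.nonneg _) (hw.2 i).1)

end Revenue

/-! ### The equilibrium bid function -/

/-- The equilibrium bid of an agent with quantile `q`. -/
noncomputable def quantileBid (fmt : PaymentFormat) (F : Measure ℝ) {n : ℕ} (w : Fin n → ℝ)
    (q : ℝ) : ℝ :=
  match fmt with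
  | .firstPrice => quantilePayment F w q / alloc w q
  | .allPay => quantilePayment F w q

section Bid

variable {fmt : PaymentFormat} {n : ℕ} {w : Fin n → ℝ} {F : Measure ℝ} [IsProbabilityMeasure F]
  {s : ℝ → ℝ}

theorem bidPayment_quantileBid (fmt : PaymentFormat) (F : Measure ℝ) {q : ℝ}
    (hpos : 0 < alloc w q) :
    bidPayment fmt (quantileBid fmt F w q) (alloc w q) = quantilePayment F w q := by
  cases fmt
  · exact div_mul_cancel₀ _ hpos.ne'
  · rfl

theorem IsSymmetricBNE.bid_eq (h : IsSymmetricBNE fmt w F s) (hw : IsPositionWeights w)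
    (hF : F (Set.Icc 0 1) = 1) (hc : Continuous (cdf F)) {i j : Fin n} (hij : w i ≠ w j)
    (hpos : ∀ q ∈ Set.Icc (0 : ℝ) 1, 0 < alloc w q) {x : ℝ} (hx : x ∈ Set.Icc (0 : ℝ) 1) :
    s x = quantileBid fmt F w (cdf F x) := by
  have hpay := h.bidPayment_eq hw hF hc hij hx
  cases fmt
  · exact (eq_div_iff (hpos _ (cdf_mem_Icc x)).ne').2 hpay
  · exact hpay

theorem quantilePayment_strictMonoOn (hw : IsPositionWeights w) (hF : F (Set.Icc 0 1) = 1)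
    (hc : Continuous (cdf F)) {i j : Fin n} (hij : w i ≠ w j) :
    StrictMonoOn (quantilePayment F w) (Set.Icc 0 1) := by
  intro p hp q hq hpq
  have hm : (p + q) / 2 ∈ Set.Ioc (0 : ℝ) 1 :=
    ⟨by linarith [hp.1], by linarith [hp.2, hq.2]⟩
  have hm' := Set.Ioc_subset_Icc_self hm
  have h1 := quantilePayment_mono (w := w) hw hF hc hp hm' (by linarith)
  have h2 := le_quantilePayment_sub (w := w) hw hF hc hm' hq (by linarith)
    fun r hr => monotoneOn_quantileValue hF hc hm' ⟨hm.1.le.trans hr.1.le, hr.2.le.trans hq.2⟩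
      hr.1.le
  have h3 := mul_pos (quantileValue_pos hF hc hm)
    (sub_pos.2 (hw.strictMonoOn_alloc hij hm' hq (by linarith)))
  linarith

/-- A first-price bid is the payment per unit of service. For `p > 0` it lies strictly below `v(p)`,
because `x(0) > 0`, while further service is charged at least `v(p)` per unit, so the average rises.
At `p = 0` the payment is zero and then becomes positive. -/
theorem quantileBid_strictMonoOn (fmt : PaymentFormat) (hw : IsPositionWeights w)
    (hF : F (Set.Icc 0 1) = 1) (hc : Continuous (cdf F)) {i j : Fin n} (hij : w i ≠ w j)
    (hpos : ∀ q ∈ Set.Icc (0 : ℝ) 1, 0 < alloc w q) :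
    StrictMonoOn (quantileBid fmt F w) (Set.Icc 0 1) := by
  cases fmt with
  | allPay => exact quantilePayment_strictMonoOn hw hF hc hij
  | firstPrice =>
    intro p hp q hq hpq
    have hB := quantilePayment_strictMonoOn hw hF hc hij hp hq hpq
    have hx := hw.strictMonoOn_alloc hij hp hq hpq
    have h0 : (0 : ℝ) ∈ Set.Icc (0 : ℝ) 1 := ⟨le_rfl, zero_le_one⟩
    have hxp := hpos p hp
    simp only [quantileBid]
    rw [div_lt_div_iff₀ hxp (hpos q hq)]
    rcases hp.1.eq_or_lt with rfl | hp0
    · rw [quantilePayment_zero] at hB ⊢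
      rw [zero_mul]
      exact mul_pos hB hxp
    · have hv := quantileValue_pos hF hc ⟨hp0, hp.2⟩
      have h1 := le_quantilePayment_sub (w := w) hw hF hc hp hq hpq.le
        fun r hr => monotoneOn_quantileValue hF hc hp ⟨hp.1.trans hr.1.le, hr.2.le.trans hq.2⟩
          hr.1.le
      have h2 := quantilePayment_le (w := w) hw hF hc hp
      have h3 : quantilePayment F w p < quantileValue F p * alloc w p :=
        h2.trans_lt (mul_lt_mul_of_pos_left (sub_lt_self _ (hpos 0 h0)) hv)
      nlinarith [mul_pos (sub_pos.2 hx) (sub_pos.2 h3), mul_le_mul_of_nonneg_right h1 hxp.le]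

theorem quantileBid_zero (fmt : PaymentFormat) (F : Measure ℝ) (w : Fin n → ℝ) :
    quantileBid fmt F w 0 = 0 := by
  cases fmt <;> simp [quantileBid, quantilePayment_zero]

theorem continuousOn_quantileBid (fmt : PaymentFormat) (hF : F (Set.Icc 0 1) = 1)
    (hc : Continuous (cdf F)) (hpos : ∀ q ∈ Set.Icc (0 : ℝ) 1, 0 < alloc w q) :
    ContinuousOn (quantileBid fmt F w) (Set.Icc 0 1) := by
  cases fmt
  · exact (continuousOn_quantilePayment hF hc w).div (continuous_alloc w).continuousOn
      fun q hq => (hpos q hq).ne'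
  · exact continuousOn_quantilePayment hF hc w

/-- Values are at most one, so payments grow no faster than `x`. In the first-price format the
increment is at most `(x(q) - x(p)) / x(q)`, and `x' ≤ L x ≤ L x(q)` on the interval. -/
theorem quantileBid_sub_le (hw : IsPositionWeights w) (hF : F (Set.Icc 0 1) = 1)
    (hc : Continuous (cdf F)) (hpos : ∀ q ∈ Set.Icc (0 : ℝ) 1, 0 < alloc w q) {L : ℝ}
    (hL : ∀ q ∈ Set.Icc (0 : ℝ) 1, allocSlope fmt w q ≤ L) {p q : ℝ}
    (hp : p ∈ Set.Icc (0 : ℝ) 1) (hq : q ∈ Set.Icc (0 : ℝ) 1) (hpq : p ≤ q) :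
    quantileBid fmt F w q - quantileBid fmt F w p ≤ L * (q - p) := by
  have hsub : Set.Icc p q ⊆ Set.Icc 0 1 := Set.Icc_subset_Icc hp.1 hq.2
  have hB := quantilePayment_sub_le (w := w) hw hF hc hp hq hpq (b := 1)
    fun r hr => (quantileValue_mem_Icc hF hc (hsub (Set.Ioo_subset_Icc_self hr))).2
  rw [one_mul] at hB
  have hmv : ∀ C, (∀ r ∈ Set.Icc p q, deriv (alloc w) r ≤ C) →
      alloc w q - alloc w p ≤ C * (q - p) := fun C hC =>
    (convex_Icc p q).image_sub_le_mul_sub_of_deriv_le (continuous_alloc w).continuousOn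
      (differentiable_alloc w).differentiableOn (fun r hr => hC r (interior_subset hr))
      p ⟨le_rfl, hpq⟩ q ⟨hpq, le_rfl⟩ hpq
  cases fmt with
  | allPay => exact hB.trans (hmv L fun r hr => hL r (hsub hr))
  | firstPrice =>
    have hxp := hpos p hp
    have hxq := hpos q hq
    have hmono := hw.monotoneOn_alloc hp hq hpq
    have hL0 : 0 ≤ L := (div_nonneg (hw.deriv_alloc_nonneg hp) hxp.le).trans (hL p hp)
    have h1 : alloc w q - alloc w p ≤ L * alloc w q * (q - p) := by
      refine hmv _ fun r hr => ?_
      have h2 := (div_le_iff₀ (hpos r (hsub hr))).1 (hL r (hsub hr))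
      exact h2.trans (mul_le_mul_of_nonneg_left (hw.monotoneOn_alloc (hsub hr) hq hr.2) hL0)
    have h3 : quantilePayment F w q / alloc w q - quantilePayment F w p / alloc w p ≤
        (alloc w q - alloc w p) / alloc w q := by
      have h4 : quantilePayment F w p / alloc w q ≤ quantilePayment F w p / alloc w p :=
        div_le_div_of_nonneg_left (quantilePayment_nonneg hw hF hc hp) hxp hmono
      have h5 := div_le_div_of_nonneg_right hB hxq.le
      rw [sub_div] at h5
      linarith
    refine h3.trans ((div_le_iff₀ hxq).2 ?_)
    linarith

/-- Bidding according to `quantileBid` is an equilibrium. -/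
theorem isSymmetricBNE_quantileBid (fmt : PaymentFormat) (hw : IsPositionWeights w)
    (hF : F (Set.Icc 0 1) = 1) (hc : Continuous (cdf F)) {i j : Fin n} (hij : w i ≠ w j)
    (hpos : ∀ q ∈ Set.Icc (0 : ℝ) 1, 0 < alloc w q) :
    IsSymmetricBNE fmt w F fun x => quantileBid fmt F w (cdf F x) := by
  have hnull := nullSingletonClass_of_continuous_cdf F hc
  have h0 : (0 : ℝ) ∈ Set.Icc (0 : ℝ) 1 := ⟨le_rfl, zero_le_one⟩
  have h1 : (1 : ℝ) ∈ Set.Icc (0 : ℝ) 1 := ⟨zero_le_one, le_rfl⟩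
  have hmono := quantileBid_strictMonoOn fmt hw hF hc hij hpos
  have hmonoc : Monotone fun x => quantileBid fmt F w (cdf F x) := fun x y hxy =>
    hmono.monotoneOn (cdf_mem_Icc x) (cdf_mem_Icc y) (monotone_cdf F hxy)
  have hmeas := hmonoc.measurable
  have hnn : ∀ q ∈ Set.Icc (0 : ℝ) 1, 0 ≤ quantileBid fmt F w q := fun q hq => by
    rw [← quantileBid_zero fmt F w]
    exact hmono.monotoneOn h0 hq hq.1
  have hatom : ∀ z, F {x | quantileBid fmt F w (cdf F x) = z} = 0 := by
    intro z
    by_cases hz : ∃ x, quantileBid fmt F w (cdf F x) = z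
    · obtain ⟨x, rfl⟩ := hz
      exact measure_mono_null (fun y hy => hmono.injOn (cdf_mem_Icc y) (cdf_mem_Icc x) hy)
        (measure_setOf_cdf_eq F (cdf F x))
    · push Not at hz
      have : {x | quantileBid fmt F w (cdf F x) = z} = ∅ :=
        Set.eq_empty_of_forall_notMem hz
      rw [this, measure_empty]
  have hX : ∀ k : Fin n, ∀ q ∈ Set.Icc (0 : ℝ) 1, interimAlloc w F
      (fun x => quantileBid fmt F w (cdf F x)) k (quantileBid fmt F w q) = alloc w q := by
    intro k q hq
    rw [interimAlloc_eq_alloc w hmeas k (hatom _)]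
    congr 1
    obtain ⟨z, -, rfl⟩ := exists_cdf_eq hF hc hq
    refine Eq.trans ?_ (measureReal_setOf_cdf_le F z)
    congr 1
    ext x
    exact hmono.le_iff_le (cdf_mem_Icc x) (cdf_mem_Icc z)
  have hopt : ∀ x : ℝ, ∀ q ∈ Set.Icc (0 : ℝ) 1,
      x * alloc w q - quantilePayment F w q ≤
        x * alloc w (cdf F x) - quantilePayment F w (cdf F x) := by
    intro x q hq
    rcases le_total q (cdf F x) with hqx | hqx
    · linarith [quantilePayment_cdf_sub_le hw hF hc hq hqx]
    · linarith [le_quantilePayment_sub_cdf hw hF hc hq hqx]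
  refine ⟨hmeas, fun x => hnn _ (cdf_mem_Icc x), fun k x _ z hz => ?_⟩
  rw [interimUtility_eq, interimUtility_eq, hX k _ (cdf_mem_Icc x),
    bidPayment_quantileBid fmt F (hpos _ (cdf_mem_Icc x))]
  -- By continuity a bid up to the top one imitates some quantile. A higher bid buys the same
  -- service as the top one and costs at least as much.
  rcases le_or_gt z (quantileBid fmt F w 1) with hz1 | hz1
  · have hivt := intermediate_value_Icc zero_le_one (continuousOn_quantileBid fmt hF hc hpos)
    rw [quantileBid_zero] at hivt
    obtain ⟨q, hq, rfl⟩ := hivt ⟨hz, hz1⟩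
    rw [hX k q hq, bidPayment_quantileBid fmt F (hpos q hq)]
    exact hopt x q hq
  · have hX1 : interimAlloc w F (fun x => quantileBid fmt F w (cdf F x)) k z = alloc w 1 := by
      rw [interimAlloc_eq_alloc w hmeas k (hatom _)]
      congr 1
      have : {x | quantileBid fmt F w (cdf F x) ≤ z} = Set.univ :=
        Set.eq_univ_of_forall fun x =>
          (hmono.monotoneOn (cdf_mem_Icc x) h1 (cdf_le_one F x)).trans hz1.le
      rw [this, probReal_univ]
    have hle : quantilePayment F w 1 ≤ bidPayment fmt z (alloc w 1) := by
      rw [← bidPayment_quantileBid fmt F (hpos 1 h1)]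
      cases fmt
      · exact mul_le_mul_of_nonneg_right hz1.le (hpos 1 h1).le
      · exact hz1.le
    rw [hX1]
    linarith [hopt x 1 h1]

end Bid

/-! ### Total variation of `Z_k` -/

theorem continuousOn_deriv_of_contDiffAt {f : ℝ → ℝ}
    (hf : ∀ q ∈ Set.Icc (0 : ℝ) 1, ContDiffAt ℝ 1 f q) :
    ContinuousOn (deriv f) (Set.Icc 0 1) := fun q hq =>
  ((hf q hq).derivWithin (m := 0) (by simp)).continuousAt.continuousWithinAt

/-- The total variation of a nonnegative unimodal function is at most twice its bound. -/
theorem integral_abs_deriv_le {f : ℝ → ℝ} (hf : ∀ q ∈ Set.Icc (0 : ℝ) 1, ContDiffAt ℝ 1 f q)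
    (hsign : ∀ p ∈ Set.Ioo (0 : ℝ) 1, ∀ q ∈ Set.Ioo (0 : ℝ) 1, p ≤ q → 0 < deriv f q →
      0 ≤ deriv f p) {C : ℝ} (hf0 : ∀ q ∈ Set.Icc (0 : ℝ) 1, 0 ≤ f q)
    (hfC : ∀ q ∈ Set.Icc (0 : ℝ) 1, f q ≤ C) :
    ∫ q in (0 : ℝ)..1, |deriv f q| ≤ 2 * C := by
  -- The supremum of `S` is the mode; inserting `0` keeps `S` nonempty when `f` never increases. The
  -- variation is `2 f(m) - f(0) - f(1)`.
  set S := insert (0 : ℝ) {q | q ∈ Set.Ioo (0 : ℝ) 1 ∧ 0 < deriv f q} with hS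
  have hS1 : ∀ q ∈ S, q ≤ 1 := by
    rintro q (rfl | hq)
    · exact zero_le_one
    · exact hq.1.2.le
  have hbdd : BddAbove S := ⟨1, hS1⟩
  have h0S : (0 : ℝ) ∈ S := Set.mem_insert _ _
  set m := sSup S with hm
  have hm0 : 0 ≤ m := le_csSup hbdd h0S
  have hm1 : m ≤ 1 := csSup_le ⟨0, h0S⟩ hS1
  have hleft : ∀ q ∈ Set.Ioo 0 m, 0 ≤ deriv f q := by
    intro q hq
    obtain ⟨p, hp, hqp⟩ := exists_lt_of_lt_csSup ⟨0, h0S⟩ hq.2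
    rcases hp with rfl | hp
    · exact absurd hq.1 hqp.not_gt
    · exact hsign q ⟨hq.1, hq.2.trans_le hm1⟩ p hp.1 hqp.le hp.2
  have hright : ∀ q ∈ Set.Ioo m 1, deriv f q ≤ 0 := by
    intro q hq
    by_contra hpos
    exact hq.1.not_ge (le_csSup hbdd (Or.inr ⟨⟨hm0.trans_lt hq.1, hq.2⟩, not_le.1 hpos⟩))
  have hcont := continuousOn_deriv_of_contDiffAt hf
  have hint : ∀ a ∈ Set.Icc (0 : ℝ) 1, ∀ b ∈ Set.Icc (0 : ℝ) 1,
      IntervalIntegrable (deriv f) volume a b := fun a ha b hb =>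
    (hcont.mono (Set.uIcc_subset_Icc ha hb)).intervalIntegrable
  have hftc : ∀ a ∈ Set.Icc (0 : ℝ) 1, ∀ b ∈ Set.Icc (0 : ℝ) 1,
      ∫ q in a..b, deriv f q = f b - f a := fun a ha b hb =>
    intervalIntegral.integral_deriv_eq_sub (fun q hq =>
      (hf q (Set.uIcc_subset_Icc ha hb hq)).differentiableAt one_ne_zero) (hint a ha b hb)
  have h0 : (0 : ℝ) ∈ Set.Icc (0 : ℝ) 1 := ⟨le_rfl, zero_le_one⟩
  have h1 : (1 : ℝ) ∈ Set.Icc (0 : ℝ) 1 := ⟨zero_le_one, le_rfl⟩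
  have hmI : m ∈ Set.Icc (0 : ℝ) 1 := ⟨hm0, hm1⟩
  have hl : ∫ q in (0 : ℝ)..m, |deriv f q| ≤ f m - f 0 := by
    rw [← hftc 0 h0 m hmI]
    exact intervalIntegral.integral_mono_on_of_le_Ioo hm0 (hint 0 h0 m hmI).abs (hint 0 h0 m hmI)
      fun q hq => (abs_of_nonneg (hleft q hq)).le
  have hr : ∫ q in m..1, |deriv f q| ≤ -(f 1 - f m) := by
    rw [← hftc m hmI 1 h1, ← intervalIntegral.integral_neg]
    exact intervalIntegral.integral_mono_on_of_le_Ioo hm1 (hint m hmI 1 h1).abs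
      (hint m hmI 1 h1).neg fun q hq => (abs_of_nonpos (hright q hq)).le
  rw [← intervalIntegral.integral_add_adjacent_intervals (hint 0 h0 m hmI).abs
    (hint m hmI 1 h1).abs]
  linarith [hf0 0 h0, hf0 1 h1, hfC m hmI]

/-- Each monomial has a nondecreasing `t * d/dt`, whatever the sign of the exponent: a negative
exponent reverses both the power and its coefficient. -/
theorem intCast_mul_zpow_le (m : ℤ) {s t : ℝ} (hs : 0 < s) (hst : s ≤ t) :
    (m : ℝ) * s ^ m ≤ m * t ^ m := by
  rcases le_total 0 m with hm | hm
  · exact mul_le_mul_of_nonneg_left (zpow_le_zpow_left₀ hm hs.le hst) (Int.cast_nonneg hm)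
  · refine mul_le_mul_of_nonpos_left ?_ (Int.cast_nonpos.2 hm)
    have h := zpow_le_zpow_left₀ (neg_nonneg.2 hm) hs.le hst
    rw [zpow_neg, zpow_neg] at h
    exact (inv_le_inv₀ (zpow_pos hs m) (zpow_pos (hs.trans_le hst) m)).1 h

/-! ### Bound and unimodality of `Z_k` -/

section ZRatio

variable {n : ℕ} {w : Fin n → ℝ} {c : ℝ}

theorem contDiff_bern (m i : ℕ) : ContDiff ℝ 1 (bern m i) := by
  unfold bern
  fun_prop

theorem bern_of_lt {m i : ℕ} (h : m < i) (q : ℝ) : bern m i q = 0 := by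
  simp [bern, Nat.choose_eq_zero_of_lt h]

theorem zRatio_succ_eq (w : Fin n → ℝ) (k : ℕ) (q : ℝ) : zRatio w (k + 1) q =
    (1 - q) * (((n - 1 : ℕ) : ℝ) * bern (n - 2) k q) / deriv (alloc w) q := by
  rw [zRatio, deriv_unitAlloc_succ]

/-- The Bernstein terms sum to one; of the `n` summands the last vanishes since the degree is `n -
2`. The bound keeps the denominator of `Z_k` away from zero up to the endpoints. -/
theorem le_deriv_alloc (hn : 2 ≤ n) (hmarg : ∀ k, c ≤ marginalWeight w k) {q : ℝ}
    (hq : q ∈ Set.Icc (0 : ℝ) 1) : c * ((n - 1 : ℕ) : ℝ) ≤ deriv (alloc w) q := by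
  have hsum : ∑ k : Fin n, bern (n - 2) k q = 1 := by
    rw [Finset.sum_fin_eq_sum_range, ← sum_bern (n - 2) q]
    obtain ⟨M, rfl⟩ := Nat.exists_eq_add_of_le' hn
    rw [Finset.sum_range_succ, dif_pos (by omega), show M + 2 - 2 = M by omega,
      bern_of_lt (Nat.lt_succ_self M), add_zero]
    exact Finset.sum_congr rfl fun i hi => dif_pos (by rw [Finset.mem_range] at hi; omega)
  calc c * ((n - 1 : ℕ) : ℝ)
      = ∑ k : Fin n, c * (((n - 1 : ℕ) : ℝ) * bern (n - 2) k q) := by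
        rw [← Finset.mul_sum, ← Finset.mul_sum, hsum, mul_one]
    _ ≤ deriv (alloc w) q := by
        rw [deriv_alloc]
        exact Finset.sum_le_sum fun k _ => mul_le_mul_of_nonneg_right (hmarg k)
          (mul_nonneg (Nat.cast_nonneg _) (bern_nonneg _ _ hq))

theorem deriv_alloc_pos (hn : 2 ≤ n) (hc : 0 < c) (hmarg : ∀ k, c ≤ marginalWeight w k) {q : ℝ}
    (hq : q ∈ Set.Icc (0 : ℝ) 1) : 0 < deriv (alloc w) q := by
  have : (0 : ℝ) < ((n - 1 : ℕ) : ℝ) := Nat.cast_pos.2 (by omega)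
  exact (mul_pos hc this).trans_le (le_deriv_alloc hn hmarg hq)

theorem contDiffAt_zRatio (hn : 2 ≤ n) (hc : 0 < c) (hmarg : ∀ k, c ≤ marginalWeight w k) (k : ℕ)
    {q : ℝ} (hq : q ∈ Set.Icc (0 : ℝ) 1) : ContDiffAt ℝ 1 (zRatio w (k + 1)) q := by
  have h1 : ContDiff ℝ 1 (deriv (alloc w)) := by
    rw [deriv_alloc]
    exact ContDiff.sum fun i _ => contDiff_const.mul (contDiff_const.mul (contDiff_bern _ _))
  have h2 : ContDiff ℝ 1 fun q => (1 - q) * (((n - 1 : ℕ) : ℝ) * bern (n - 2) k q) :=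
    (contDiff_const.sub contDiff_id).mul (contDiff_const.mul (contDiff_bern _ _))
  have h3 := h2.contDiffAt.div h1.contDiffAt (deriv_alloc_pos hn hc hmarg hq).ne'
  exact h3.congr_of_eventuallyEq (Filter.Eventually.of_forall fun q => zRatio_succ_eq w k q)

theorem zRatio_nonneg (hn : 2 ≤ n) (hc : 0 < c) (hmarg : ∀ k, c ≤ marginalWeight w k) (k : ℕ)
    {q : ℝ} (hq : q ∈ Set.Icc (0 : ℝ) 1) : 0 ≤ zRatio w (k + 1) q := by
  rw [zRatio_succ_eq]
  exact div_nonneg (mul_nonneg (sub_nonneg.2 hq.2) (mul_nonneg (Nat.cast_nonneg _)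
    (bern_nonneg _ _ hq))) (deriv_alloc_pos hn hc hmarg hq).le

/-- One summand of `x'` is already at least `c` times the derivative in the numerator. -/
theorem zRatio_le (hn : 2 ≤ n) (hc : 0 < c) (hmarg : ∀ k, c ≤ marginalWeight w k) {k : ℕ}
    (hk : k < n) {q : ℝ} (hq : q ∈ Set.Icc (0 : ℝ) 1) : zRatio w (k + 1) q ≤ c⁻¹ := by
  have hnn : ∀ i, 0 ≤ ((n - 1 : ℕ) : ℝ) * bern (n - 2) i q := fun i =>
    mul_nonneg (Nat.cast_nonneg _) (bern_nonneg _ _ hq)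
  rw [zRatio_succ_eq, div_le_iff₀ (deriv_alloc_pos hn hc hmarg hq), inv_mul_eq_div,
    le_div_iff₀ hc, deriv_alloc]
  calc (1 - q) * (((n - 1 : ℕ) : ℝ) * bern (n - 2) k q) * c
      ≤ 1 * (((n - 1 : ℕ) : ℝ) * bern (n - 2) k q) * c :=
        mul_le_mul_of_nonneg_right (mul_le_mul_of_nonneg_right (by linarith [hq.1]) (hnn k)) hc.le
    _ = c * (((n - 1 : ℕ) : ℝ) * bern (n - 2) k q) := by ring
    _ ≤ marginalWeight w ⟨k, hk⟩ * (((n - 1 : ℕ) : ℝ) * bern (n - 2) k q) :=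
        mul_le_mul_of_nonneg_right (hmarg ⟨k, hk⟩) (hnn k)
    _ ≤ _ := Finset.single_le_sum
        (f := fun i : Fin n => marginalWeight w i * (((n - 1 : ℕ) : ℝ) * bern (n - 2) i q))
        (fun i _ => mul_nonneg (hc.le.trans (hmarg i)) (hnn i)) (Finset.mem_univ (⟨k, hk⟩ : Fin n))

theorem bern_eq_mul_zpow {m i k : ℕ} (hk : k ≤ m) {q : ℝ} (hq : q ∈ Set.Ioo (0 : ℝ) 1) :
    bern m i q = (m.choose i : ℝ) * (q / (1 - q)) ^ ((k : ℤ) - i) *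
      (q ^ (m - k) * (1 - q) ^ k) := by
  rcases lt_or_ge m i with hi | hi
  · simp [bern, Nat.choose_eq_zero_of_lt hi]
  have h0 : q ≠ 0 := hq.1.ne'
  have h1 : 1 - q ≠ 0 := (sub_pos.2 hq.2).ne'
  rw [bern, mul_assoc, mul_assoc, div_zpow]
  congr 1
  have e1 : q ^ (m - i) = q ^ ((k : ℤ) - i) * q ^ (m - k) := by
    rw [← zpow_natCast, ← zpow_natCast, ← zpow_add₀ h0]
    congr 1
    omega
  have e2 : (1 - q) ^ k = (1 - q) ^ ((k : ℤ) - i) * (1 - q) ^ i := by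
    rw [← zpow_natCast, ← zpow_natCast, ← zpow_add₀ h1]
    congr 1
    omega
  rw [e1, e2]
  have := zpow_ne_zero ((k : ℤ) - i) h1
  field_simp

/-- In the odds `t = q / (1 - q)`, the reciprocal of `Z_k` is a Laurent polynomial with
nonnegative coefficients. -/
noncomputable def zDenom (w : Fin n → ℝ) (k : ℕ) (t : ℝ) : ℝ :=
  ∑ j : Fin n, marginalWeight w j * ((n - 2).choose j : ℝ) *
    (t ^ ((k : ℤ) - (j : ℕ)) + t ^ ((k : ℤ) - (j : ℕ) + 1))

/-- The logarithmic derivative `t ↦ t * zDenom' t`. -/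
noncomputable def zDenomLogDeriv (w : Fin n → ℝ) (k : ℕ) (t : ℝ) : ℝ :=
  ∑ j : Fin n, marginalWeight w j * ((n - 2).choose j : ℝ) *
    ((((k : ℤ) - (j : ℕ) : ℤ) : ℝ) * t ^ ((k : ℤ) - (j : ℕ)) +
      (((k : ℤ) - (j : ℕ) + 1 : ℤ) : ℝ) * t ^ ((k : ℤ) - (j : ℕ) + 1))

theorem hasDerivAt_zDenom (w : Fin n → ℝ) (k : ℕ) {t : ℝ} (ht : 0 < t) :
    HasDerivAt (zDenom w k) (zDenomLogDeriv w k t / t) t := by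
  have hz : ∀ m : ℤ, HasDerivAt (fun t : ℝ => t ^ m) ((m : ℝ) * t ^ m / t) t := fun m =>
    (hasDerivAt_zpow m t (Or.inl ht.ne')).congr_deriv (by rw [zpow_sub_one₀ ht.ne']; ring)
  unfold zDenom zDenomLogDeriv
  rw [Finset.sum_div]
  refine HasDerivAt.fun_sum fun j _ => ?_
  refine (((hz _).add (hz _)).const_mul _).congr_deriv ?_
  ring

theorem zDenomLogDeriv_mono (hmarg : ∀ k, 0 ≤ marginalWeight w k) (k : ℕ) {s t : ℝ} (hs : 0 < s)
    (hst : s ≤ t) : zDenomLogDeriv w k s ≤ zDenomLogDeriv w k t :=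
  Finset.sum_le_sum fun j _ => mul_le_mul_of_nonneg_left
    (add_le_add (intCast_mul_zpow_le _ hs hst) (intCast_mul_zpow_le _ hs hst))
    (mul_nonneg (hmarg j) (Nat.cast_nonneg _))

/-- Ratios of Bernstein terms are powers of the odds, and `1 / (1 - q) = 1 + t`, whence the paired
exponents in `zDenom`. -/
theorem zRatio_eq_div_zDenom (hn : 2 ≤ n) (w : Fin n → ℝ) {k : ℕ} (hk : k ≤ n - 2) {q : ℝ}
    (hq : q ∈ Set.Ioo (0 : ℝ) 1) :
    zRatio w (k + 1) q = ((n - 2).choose k : ℝ) / zDenom w k (q / (1 - q)) := by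
  have h0 : q ≠ 0 := hq.1.ne'
  have h1 : 1 - q ≠ 0 := (sub_pos.2 hq.2).ne'
  have hn1 : ((n - 1 : ℕ) : ℝ) ≠ 0 := Nat.cast_ne_zero.2 (by omega)
  have hden : deriv (alloc w) q = ((n - 1 : ℕ) : ℝ) * (1 - q) * (q ^ (n - 2 - k) * (1 - q) ^ k) *
      zDenom w k (q / (1 - q)) := by
    rw [deriv_alloc, zDenom, Finset.mul_sum]
    refine Finset.sum_congr rfl fun j _ => ?_
    rw [bern_eq_mul_zpow hk hq, zpow_add_one₀ (div_ne_zero h0 h1)]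
    field_simp
    ring
  have hne : ((n - 1 : ℕ) : ℝ) * (1 - q) * (q ^ (n - 2 - k) * (1 - q) ^ k) ≠ 0 :=
    mul_ne_zero (mul_ne_zero hn1 h1) (mul_ne_zero (pow_ne_zero _ h0) (pow_ne_zero _ h1))
  rw [zRatio_succ_eq, hden, ← mul_div_mul_left _ (zDenom w k (q / (1 - q))) hne, bern]
  congr 1
  ring

theorem zDenom_pos (hc : 0 < c) (hmarg : ∀ k, c ≤ marginalWeight w k) (hn : 0 < n) (k : ℕ)
    {t : ℝ} (ht : 0 < t) : 0 < zDenom w k t := by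
  refine Finset.sum_pos' (fun j _ => mul_nonneg (mul_nonneg (hc.le.trans (hmarg j))
    (Nat.cast_nonneg _)) (by positivity)) ⟨⟨0, hn⟩, Finset.mem_univ _, ?_⟩
  have := hc.trans_le (hmarg ⟨0, hn⟩)
  simp only [Nat.choose_zero_right, Nat.cast_one, mul_one]
  positivity

/-- What matters is the sign: the derivative is a nonnegative factor times `-zDenomLogDeriv`, which
is nonincreasing in the odds. -/
theorem deriv_zRatio (hn : 2 ≤ n) (hc : 0 < c) (hmarg : ∀ k, c ≤ marginalWeight w k) {k : ℕ}
    (hk : k ≤ n - 2) {q : ℝ} (hq : q ∈ Set.Ioo (0 : ℝ) 1) :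
    deriv (zRatio w (k + 1)) q = ((n - 2).choose k : ℝ) / zDenom w k (q / (1 - q)) ^ 2 /
      (q * (1 - q)) * -zDenomLogDeriv w k (q / (1 - q)) := by
  have h1 : 0 < 1 - q := sub_pos.2 hq.2
  have ht : 0 < q / (1 - q) := div_pos hq.1 h1
  have hodds : HasDerivAt (fun q : ℝ => q / (1 - q)) (1 / (1 - q) ^ 2) q := by
    refine ((hasDerivAt_id q).div ((hasDerivAt_id q).const_sub 1) h1.ne').congr_deriv ?_
    simp
  have hV := (hasDerivAt_zDenom w k ht).comp q hodds
  have hVpos := zDenom_pos hc hmarg (by omega) k ht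
  have hZ := (hasDerivAt_const q ((n - 2).choose k : ℝ)).div hV hVpos.ne'
  have heq : zRatio w (k + 1) =ᶠ[nhds q] (fun _ => ((n - 2).choose k : ℝ)) /
      (zDenom w k ∘ fun q : ℝ => q / (1 - q)) := by
    filter_upwards [Ioo_mem_nhds hq.1 hq.2] with p hp
    exact zRatio_eq_div_zDenom hn w hk hp
  rw [(hZ.congr_of_eventuallyEq heq).deriv]
  have hq0 := hq.1.ne'
  simp only [Function.comp_apply]
  field_simp
  ring

theorem integral_abs_deriv_zRatio_le (hn : 2 ≤ n) (hc : 0 < c)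
    (hmarg : ∀ k, c ≤ marginalWeight w k) {k : ℕ} (hk : k < n) :
    ∫ q in (0 : ℝ)..1, |deriv (zRatio w (k + 1)) q| ≤ 2 * c⁻¹ := by
  refine integral_abs_deriv_le (fun q hq => contDiffAt_zRatio hn hc hmarg k hq) ?_
    (fun q hq => zRatio_nonneg hn hc hmarg k hq) (fun q hq => zRatio_le hn hc hmarg hk hq)
  intro p hp q hq hpq hpos
  rcases le_or_gt k (n - 2) with hk2 | hk2
  · rw [deriv_zRatio hn hc hmarg hk2 hq] at hpos
    rw [deriv_zRatio hn hc hmarg hk2 hp]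
    have hp1 : 0 < 1 - p := sub_pos.2 hp.2
    have hq1 : 0 < 1 - q := sub_pos.2 hq.2
    have hfac : ∀ r ∈ Set.Ioo (0 : ℝ) 1, 0 ≤ ((n - 2).choose k : ℝ) /
        zDenom w k (r / (1 - r)) ^ 2 / (r * (1 - r)) := fun r hr => by
      have := hr.1
      have := sub_pos.2 hr.2
      positivity
    refine mul_nonneg (hfac p hp) ?_
    have h1 : 0 < -zDenomLogDeriv w k (q / (1 - q)) := by
      by_contra hle
      exact hpos.not_ge (mul_nonpos_of_nonneg_of_nonpos (hfac q hq) (not_lt.1 hle))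
    have h2 := zDenomLogDeriv_mono (w := w) (fun k => hc.le.trans (hmarg k)) k
      (div_pos hp.1 hp1) (div_le_div₀ hq.1.le hpq hq1 (by linarith) : p / (1 - p) ≤ q / (1 - q))
    linarith
  -- This is the case `k + 1 = n`: serving everybody is a constant rule, so `Z_n` vanishes.
  · have hzero : zRatio w (k + 1) = fun _ => 0 := by
      ext q
      rw [zRatio_succ_eq, bern_of_lt hk2]
      simp
    rw [hzero]
    simp

/-- The multi-unit revenue in terms of the equilibrium payments. -/
theorem multiUnitRevenue_eq {F : Measure ℝ} [IsProbabilityMeasure F] (hF : F (Set.Icc 0 1) = 1)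
    (hFc : Continuous (cdf F)) (hn : 2 ≤ n) (hc : 0 < c)
    (hmarg : ∀ k, c ≤ marginalWeight w k) (k : ℕ) :
    multiUnitRevenue F n (k + 1) =
      -∫ q in (0 : ℝ)..1, deriv (zRatio w (k + 1)) q * quantilePayment F w q := by
  have h := integral_deriv_mul_primitive
    (fun q hq => contDiffAt_zRatio hn hc hmarg k hq) (by simp [zRatio])
    (intervalIntegrable_quantilePayment hF hFc w)
  unfold quantilePayment
  rw [h, neg_neg, multiUnitRevenue]
  refine intervalIntegral.integral_congr fun q hq => ?_
  rw [Set.uIcc_of_le zero_le_one] at hq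
  have := (deriv_alloc_pos hn hc hmarg hq).ne'
  simp only [zRatio, revenueCurve]
  field_simp

end ZRatio

/-! ### Order statistics -/

/-- With `N + 2` agents, the rule `unitAlloc (N + 2) (m + 1)` is a primitive of `N + 1` times the
integrand and rises from `0` to `1`. -/
theorem integral_bern {N m : ℕ} (hm : m ≤ N) :
    ∫ u in (0 : ℝ)..1, bern N m u = 1 / ((N : ℝ) + 1) := by
  have h := intervalIntegral.integral_eq_sub_of_hasDerivAt
    (fun u _ => hasDerivAt_unitAlloc_succ (N + 2) m u)
    ((continuous_const.mul (continuous_bern _ _)).intervalIntegrable 0 1)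
  have h1 : unitAlloc (N + 2) (m + 1) 1 = 1 := by
    rw [unitAlloc_eq_sum_bern, Finset.sum_range_succ', Finset.sum_eq_zero]
    · simp [bern]
    · intro i _
      simp [bern]
  have h0 : unitAlloc (N + 2) (m + 1) 0 = 0 := by
    rw [unitAlloc_eq_sum_bern]
    refine Finset.sum_eq_zero fun i hi => ?_
    have : N + 1 - i ≠ 0 := by have := Finset.mem_range.1 hi; omega
    simp [bern, this]
  rw [h1, h0, sub_zero, intervalIntegral.integral_const_mul] at h
  rw [eq_div_iff (by positivity), mul_comm]
  simpa using h

theorem one_sub_mul_bern (N m : ℕ) (u : ℝ) :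
    (1 - u) * bern N m u = ((m : ℝ) + 1) / ((N : ℝ) + 1) * bern (N + 1) (m + 1) u := by
  have h := Nat.add_one_mul_choose_eq N m
  have h' : ((N : ℝ) + 1) * (N.choose m : ℝ) = ((N + 1).choose (m + 1) : ℝ) * ((m : ℝ) + 1) := by
    exact_mod_cast h
  have hN : (N : ℝ) + 1 ≠ 0 := by positivity
  rw [bern, bern, Nat.add_sub_add_right, div_mul_eq_mul_div, eq_div_iff hN, pow_succ]
  linear_combination (u ^ (N - m) * (1 - u) ^ m * (1 - u)) * h'

theorem integral_sub_mul_bern {N m : ℕ} (hm : m ≤ N) (q : ℝ) :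
    ∫ u in (0 : ℝ)..1, 2 * (u - q) * bern N m (1 - u) =
      2 / (((N : ℝ) + 1) * ((N : ℝ) + 2)) * ((m : ℝ) + 1) - 2 * q / ((N : ℝ) + 1) := by
  have hsub := intervalIntegral.integral_comp_sub_left (a := (0 : ℝ)) (b := 1)
    (fun u => 2 * (1 - u - q) * bern N m u) 1
  simp only [sub_sub_cancel, sub_self, sub_zero] at hsub
  rw [hsub]
  have hfun : ∀ u : ℝ, 2 * (1 - u - q) * bern N m u =
      2 * (((m : ℝ) + 1) / ((N : ℝ) + 1)) * bern (N + 1) (m + 1) u - 2 * q * bern N m u := by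
    intro u
    linear_combination 2 * one_sub_mul_bern N m u
  simp_rw [hfun]
  have hint : ∀ (a : ℝ) (M l : ℕ), IntervalIntegrable (fun u => a * bern M l u) volume 0 1 :=
    fun a M l => (continuous_const.mul (continuous_bern M l)).intervalIntegrable 0 1
  rw [intervalIntegral.integral_sub (hint _ _ _) (hint _ _ _),
    intervalIntegral.integral_const_mul, intervalIntegral.integral_const_mul, integral_bern hm,
    integral_bern (Nat.succ_le_succ hm)]
  push_cast
  field_simp
  ring

theorem sum_ite_lt_linear {i K : ℕ} (hi : i ≤ K) (a b : ℝ) :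
    ∑ m ∈ Finset.range (K + 1), (if i < m then (1 : ℝ) else 0) * (a * ((m : ℝ) + 1) - b) =
      a * (((K : ℝ) + 1) * (K + 2) - ((i : ℝ) + 1) * (i + 2)) / 2 - b * ((K : ℝ) - i) := by
  induction K, hi using Nat.le_induction with
  | base =>
    rw [Finset.sum_eq_zero]
    · ring
    · intro m hm
      rw [if_neg (by rw [Finset.mem_range] at hm; omega), zero_mul]
  | succ K hK ih =>
    rw [Finset.sum_range_succ, ih, if_pos (by omega)]
    push_cast
    ring

section OrderStatistic

variable {N : ℕ}

/-- The `i`-th smallest entry of `B`. -/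
noncomputable def orderStat (B : Fin N → ℝ) (i : Fin N) : ℝ := B (Tuple.sort B i)

/-- The index starts at `0`, hence the strict inequality. Events about an order statistic become
events about a binomial count. -/
theorem orderStat_le_iff (B : Fin N → ℝ) (i : Fin N) (u : ℝ) :
    orderStat B i ≤ u ↔ (i : ℕ) < (Finset.univ.filter fun j => B j ≤ u).card := by
  have h := Tuple.lt_card_le_iff_apply_le_of_monotone (j := i) (a := u) (Tuple.monotone_sort B)
  rw [orderStat, ← Function.comp_apply (f := B), ← h]
  have : (Finset.univ.filter fun j => B j ≤ u).card =
      (Finset.univ.filter fun j => (B ∘ Tuple.sort B) j ≤ u).card := by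
    refine (Finset.card_bij (fun j _ => Tuple.sort B j) ?_ ?_ ?_).symm
    · simp
    · simp
    · intro j hj
      exact ⟨(Tuple.sort B).symm j, by simpa using hj, by simp⟩
  rw [this]

theorem measurable_orderStat (i : Fin N) : Measurable fun B : Fin N → ℝ => orderStat B i := by
  refine measurable_of_Iic fun u => ?_
  have hcard : Measurable fun B : Fin N → ℝ => (Finset.univ.filter fun j => B j ≤ u).card := by
    simp_rw [Finset.card_filter]
    exact Finset.measurable_fun_sum _ fun j _ => Measurable.ite
      (measurableSet_le (measurable_pi_apply j) measurable_const) measurable_const measurable_const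
  have : (fun B : Fin N → ℝ => orderStat B i) ⁻¹' Set.Iic u =
      {B : Fin N → ℝ | (i : ℕ) < (Finset.univ.filter fun j => B j ≤ u).card} := by
    ext B
    exact orderStat_le_iff B i u
  rw [this]
  exact measurableSet_lt measurable_const hcard

theorem orderStat_comp {β : ℝ → ℝ} (hβ : MonotoneOn β (Set.Icc 0 1)) {U : Fin N → ℝ}
    (hU : ∀ j, U j ∈ Set.Icc (0 : ℝ) 1) (i : Fin N) :
    orderStat (fun j => β (U j)) i = β (orderStat U i) := by
  have h : Monotone ((fun j => β (U j)) ∘ Tuple.sort U) := fun a b hab =>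
    hβ (hU _) (hU _) (Tuple.monotone_sort U hab)
  have := congrFun (Tuple.comp_sort_eq_comp_iff_monotone.2 h) i
  exact this.symm

theorem estimatedBid_eq_sum (B : Fin N → ℝ) (q : ℝ) :
    estimatedBid B q = ∑ i : Fin N, if 0 ≤ q ∧ ⌊q * N⌋₊ = i then orderStat B i else 0 := by
  by_cases h : 0 ≤ q ∧ ⌊q * N⌋₊ < N
  · rw [estimatedBid, dif_pos h, Finset.sum_eq_single ⟨⌊q * N⌋₊, h.2⟩]
    · rw [if_pos ⟨h.1, rfl⟩]
      rfl
    · intro i _ hi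
      exact if_neg fun hq => hi (Fin.ext hq.2.symm)
    · simp
  · rw [estimatedBid, dif_neg h]
    refine (Finset.sum_eq_zero fun i _ => if_neg ?_).symm
    rintro ⟨hq, hi⟩
    exact h ⟨hq, hi ▸ i.2⟩

theorem measurable_estimatedBid :
    Measurable fun p : (Fin N → ℝ) × ℝ => estimatedBid p.1 p.2 := by
  simp_rw [estimatedBid_eq_sum]
  refine Finset.measurable_fun_sum _ fun i _ => Measurable.ite ?_
    ((measurable_orderStat i).comp measurable_fst) measurable_const
  exact (measurableSet_le measurable_const measurable_snd).inter
    (measurableSet_eq_fun (Nat.measurable_floor.comp (measurable_snd.mul_const _))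
      measurable_const)

theorem isProbabilityMeasure_restrict_Icc :
    IsProbabilityMeasure ((volume : Measure ℝ).restrict (Set.Icc 0 1)) :=
  ⟨by simp⟩

/-- A layer-cake formula: it lets the second moment of an order statistic be computed from its
distribution function alone. -/
theorem integral_ite_le_restrict {T : ℝ} (hT : T ∈ Set.Icc (0 : ℝ) 1) (q : ℝ) :
    ∫ u in Set.Icc (0 : ℝ) 1, (if T ≤ u then 2 * (u - q) else 0) = (1 - q) ^ 2 - (T - q) ^ 2 := by
  have h1 : (fun u : ℝ => if T ≤ u then 2 * (u - q) else 0) =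
      (Set.Ici T).indicator fun u => 2 * (u - q) := by
    ext u
    simp [Set.indicator_apply]
  have h2 : Set.Ici T ∩ Set.Icc 0 1 = Set.Icc T 1 := by
    ext u
    simp only [Set.mem_inter_iff, Set.mem_Ici, Set.mem_Icc]
    exact ⟨fun h => ⟨h.1, h.2.2⟩, fun h => ⟨h.1, hT.1.trans h.1, h.2⟩⟩
  rw [h1, integral_indicator measurableSet_Ici, Measure.restrict_restrict measurableSet_Ici, h2,
    integral_Icc_eq_integral_Ioc, ← intervalIntegral.integral_of_le hT.2]
  exact intervalIntegral.integral_eq_sub_of_hasDerivAt (f := fun u => (u - q) ^ 2)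
    (fun u _ => (((hasDerivAt_id u).sub_const q).pow 2).congr_deriv (by simp))
    (Continuous.intervalIntegrable (by fun_prop) _ _)

/-- The second moment of the `i`-th order statistic of `N` uniform quantiles about `q`. -/
theorem integral_orderStat_sub_sq (i : Fin N) (q : ℝ) :
    ∫ U, (orderStat U i - q) ^ 2
      ∂(Measure.pi fun _ : Fin N => (volume : Measure ℝ).restrict (Set.Icc 0 1)) =
      q ^ 2 - 2 * q * ((i : ℝ) + 1) / ((N : ℝ) + 1) +
        ((i : ℝ) + 1) * ((i : ℝ) + 2) / (((N : ℝ) + 1) * ((N : ℝ) + 2)) := by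
  have hprob := isProbabilityMeasure_restrict_Icc
  set lam := (volume : Measure ℝ).restrict (Set.Icc 0 1) with hlam
  set P := Measure.pi fun _ : Fin N => lam
  have hI : ∀ᵐ u ∂lam, u ∈ Set.Icc (0 : ℝ) 1 := ae_restrict_mem measurableSet_Icc
  have hU : ∀ᵐ U ∂P, ∀ j, U j ∈ Set.Icc (0 : ℝ) 1 := ae_all_iff.2 fun j =>
    (Measure.quasiMeasurePreserving_eval (fun _ : Fin N => lam) j).ae hI
  have hmeas : Measurable fun p : (Fin N → ℝ) × ℝ =>
      if orderStat p.1 i ≤ p.2 then 2 * (p.2 - q) else 0 :=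
    Measurable.ite (measurableSet_le ((measurable_orderStat i).comp measurable_fst) measurable_snd)
      (measurable_const.mul (measurable_snd.sub_const q)) measurable_const
  have hint : Integrable (fun p : (Fin N → ℝ) × ℝ =>
      if orderStat p.1 i ≤ p.2 then 2 * (p.2 - q) else 0) (P.prod lam) := by
    refine Integrable.of_bound (C := 2 * (1 + |q|)) hmeas.aestronglyMeasurable ?_
    filter_upwards [(Measure.quasiMeasurePreserving_snd (μ := P) (ν := lam)).ae hI] with p hp
    split_ifs
    · rw [Real.norm_eq_abs, abs_mul, abs_two]
      have h1 := abs_sub p.2 q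
      rw [abs_of_nonneg hp.1] at h1
      linarith [hp.2]
    · rw [norm_zero]
      positivity
  have hstep : ∫ U, (orderStat U i - q) ^ 2 ∂P = (1 - q) ^ 2 -
      ∫ u, ∫ U, (if orderStat U i ≤ u then 2 * (u - q) else 0) ∂P ∂lam := by
    rw [← integral_integral_swap (f := fun U u => if orderStat U i ≤ u then 2 * (u - q) else 0) hint]
    have h1 : ∫ U, (orderStat U i - q) ^ 2 ∂P = ∫ U, ((1 - q) ^ 2 -
        ∫ u, (if orderStat U i ≤ u then 2 * (u - q) else 0) ∂lam) ∂P := by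
      refine integral_congr_ae ?_
      filter_upwards [hU] with U hU
      have hT : orderStat U i ∈ Set.Icc (0 : ℝ) 1 := hU _
      rw [hlam, integral_ite_le_restrict hT]
      ring
    rw [h1, integral_sub (integrable_const _) hint.integral_prod_left, integral_const,
      probReal_univ, one_smul]
  -- For fixed `u` the number of samples in `Iic u` is binomial, so the distribution function of the
  -- order statistic is a sum of Bernstein terms.
  have hinner : ∀ u ∈ Set.Icc (0 : ℝ) 1,
      ∫ U, (if orderStat U i ≤ u then 2 * (u - q) else 0) ∂P =
        ∑ m ∈ Finset.range (N + 1), (if (i : ℕ) < m then (1 : ℝ) else 0) *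
          (2 * (u - q) * bern N m (1 - u)) := by
    intro u hu
    have hreal : lam.real (Set.Iic u) = u := by
      have : Set.Iic u ∩ Set.Icc 0 1 = Set.Icc 0 u := by
        ext x
        simp only [Set.mem_inter_iff, Set.mem_Iic, Set.mem_Icc]
        exact ⟨fun h => ⟨h.2.1, h.1⟩, fun h => ⟨h.2, h.1, h.2.trans hu.2⟩⟩
      rw [measureReal_def, hlam, Measure.restrict_apply measurableSet_Iic, this, Real.volume_Icc,
        sub_zero, ENNReal.toReal_ofReal hu.1]
    have hcount := integral_card_filter_mem (μ := lam) (A := Set.Iic u) measurableSet_Iic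
      (Finset.univ : Finset (Fin N)) (fun m => if (i : ℕ) < m then (1 : ℝ) else 0)
    rw [hreal, Finset.card_univ, Fintype.card_fin] at hcount
    have h1 : ∀ U : Fin N → ℝ, (if orderStat U i ≤ u then 2 * (u - q) else 0) =
        2 * (u - q) * (if (i : ℕ) < (Finset.univ.filter fun j => U j ∈ Set.Iic u).card
          then (1 : ℝ) else 0) := by
      intro U
      simp only [orderStat_le_iff, Set.mem_Iic, mul_ite, mul_one, mul_zero]
    simp_rw [h1]
    rw [integral_const_mul, hcount, Finset.mul_sum]
    refine Finset.sum_congr rfl fun m _ => ?_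
    rw [bern, sub_sub_cancel]
    ring
  have hiN : (i : ℕ) ≤ N := i.2.le
  rw [hstep, hlam, setIntegral_congr_fun measurableSet_Icc hinner, integral_Icc_eq_integral_Ioc,
    ← intervalIntegral.integral_of_le zero_le_one, intervalIntegral.integral_finsetSum]
  · simp_rw [intervalIntegral.integral_const_mul _ (fun u : ℝ => 2 * (u - q) * bern N _ (1 - u))]
    rw [Finset.sum_congr rfl fun m hm => by
      rw [integral_sub_mul_bern (Nat.lt_succ_iff.1 (Finset.mem_range.1 hm)) q],
      sum_ite_lt_linear hiN]
    field_simp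
    ring
  · intro m _
    have := continuous_bern N m
    exact Continuous.intervalIntegrable (by fun_prop) _ _

/-- Squared bias plus variance about the mean `(i + 1) / (N + 1)`. The bias is at most `1 / (N + 1)`
for `q` in its cell, and each of the two terms is at most `1 / (4 N)`. -/
theorem integral_orderStat_sub_sq_le (i : Fin N) {q : ℝ} (hq0 : (i : ℝ) ≤ q * N)
    (hq1 : q * N ≤ (i : ℝ) + 1) :
    ∫ U, (orderStat U i - q) ^ 2
      ∂(Measure.pi fun _ : Fin N => (volume : Measure ℝ).restrict (Set.Icc 0 1)) ≤
      1 / (2 * N) := by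
  rw [integral_orderStat_sub_sq]
  have hN : (0 : ℝ) < N := Nat.cast_pos.2 i.pos
  have ha0 : (0 : ℝ) ≤ i := Nat.cast_nonneg _
  have ha1 : (i : ℝ) + 1 ≤ N := by exact_mod_cast i.2
  have hsplit : q ^ 2 - 2 * q * ((i : ℝ) + 1) / ((N : ℝ) + 1) +
      ((i : ℝ) + 1) * ((i : ℝ) + 2) / (((N : ℝ) + 1) * ((N : ℝ) + 2)) =
      (q - ((i : ℝ) + 1) / ((N : ℝ) + 1)) ^ 2 +
        ((i : ℝ) + 1) * ((N : ℝ) - i) / (((N : ℝ) + 1) ^ 2 * ((N : ℝ) + 2)) := by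
    field_simp
    ring
  have hbias : |q - ((i : ℝ) + 1) / ((N : ℝ) + 1)| ≤ 1 / ((N : ℝ) + 1) := by
    have h1 : q - ((i : ℝ) + 1) / ((N : ℝ) + 1) = (q * (N + 1) - (i + 1)) / ((N : ℝ) + 1) := by
      field_simp
    have hqnn : 0 ≤ q := nonneg_of_mul_nonneg_left (ha0.trans hq0) hN
    have hq1' : q ≤ 1 := by
      by_contra h
      nlinarith
    rw [h1, abs_div, abs_of_pos (by positivity : (0 : ℝ) < N + 1)]
    refine div_le_div_of_nonneg_right ?_ (by positivity)
    rw [abs_le]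
    constructor <;> linarith
  have hsq : (q - ((i : ℝ) + 1) / ((N : ℝ) + 1)) ^ 2 ≤ 1 / (4 * N) := by
    refine (sq_le_sq' (abs_le.1 hbias).1 (abs_le.1 hbias).2).trans ?_
    rw [div_pow, one_pow]
    exact one_div_le_one_div_of_le (by positivity) (by nlinarith [sq_nonneg ((N : ℝ) - 1)])
  have hvar : ((i : ℝ) + 1) * ((N : ℝ) - i) / (((N : ℝ) + 1) ^ 2 * ((N : ℝ) + 2)) ≤
      1 / (4 * N) := by
    rw [div_le_div_iff₀ (by positivity) (by positivity)]
    have h1 : ((i : ℝ) + 1) * ((N : ℝ) - i) * 4 ≤ ((N : ℝ) + 1) ^ 2 := by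
      nlinarith [sq_nonneg (((i : ℝ) + 1) - ((N : ℝ) - i))]
    nlinarith [mul_le_mul_of_nonneg_right h1 hN.le, sq_nonneg ((N : ℝ) + 1)]
  rw [hsplit]
  have : 1 / (2 * (N : ℝ)) = 1 / (4 * N) + 1 / (4 * N) := by
    field_simp
    norm_num
  linarith

end OrderStatistic

/-! ### Mean squared error of weighted averages -/

section MeanSquare

variable {α Ω : Type*} [MeasurableSpace α] [MeasurableSpace Ω] {ν : Measure α} {P : Measure Ω}

theorem integrable_mul_of_abs_le_one {a d : α → ℝ} (ha : Integrable a ν)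
    (hd : AEStronglyMeasurable d ν) (hb : ∀ᵐ q ∂ν, |d q| ≤ 1) :
    Integrable (fun q => a q * d q) ν := by
  refine Integrable.mono' ha.abs (ha.aestronglyMeasurable.mul hd) ?_
  filter_upwards [hb] with q hq
  rw [Real.norm_eq_abs, abs_mul]
  exact mul_le_of_le_one_right (abs_nonneg _) hq

theorem abs_sq_le_one {x : ℝ} (hx : |x| ≤ 1) : |x ^ 2| ≤ 1 := by
  rw [abs_pow]
  exact pow_le_one₀ (abs_nonneg _) hx

/-- The Cauchy–Schwarz inequality for the weight `|a|`. -/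
theorem sq_integral_mul_le {a d : α → ℝ} (ha : Integrable a ν) (hd : AEStronglyMeasurable d ν)
    (hb : ∀ᵐ q ∂ν, |d q| ≤ 1) :
    (∫ q, a q * d q ∂ν) ^ 2 ≤ (∫ q, |a q| ∂ν) * ∫ q, |a q| * d q ^ 2 ∂ν := by
  have hd2 : AEStronglyMeasurable (fun q => d q ^ 2) ν := hd.pow 2
  have hdabs : AEStronglyMeasurable (fun q => |d q|) ν := hd.norm
  have h1 : Integrable (fun q => |a q| * |d q|) ν := integrable_mul_of_abs_le_one ha.abs hdabs
    (hb.mono fun q hq => by rwa [abs_abs])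
  have h2 : Integrable (fun q => |a q| * d q ^ 2) ν := integrable_mul_of_abs_le_one ha.abs hd2
    (hb.mono fun q hq => abs_sq_le_one hq)
  set T := ∫ q, |a q| ∂ν with hT
  set m := ∫ q, |a q| * |d q| ∂ν with hm
  set S := ∫ q, |a q| * d q ^ 2 ∂ν with hS
  have hT0 : 0 ≤ T := integral_nonneg fun q => abs_nonneg _
  have hm0 : 0 ≤ m := integral_nonneg fun q => mul_nonneg (abs_nonneg _) (abs_nonneg _)
  have hmT : m ≤ T := integral_mono_ae h1 ha.abs (hb.mono fun q hq =>
    mul_le_of_le_one_right (abs_nonneg _) hq)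
  have habs : |∫ q, a q * d q ∂ν| ≤ m := by
    refine (abs_integral_le_integral_abs).trans (le_of_eq ?_)
    simp_rw [abs_mul]
    exact hm.symm
  -- The integral of `|a| (T |d| - m)²` is nonnegative, which reads `T (T S - m²) ≥ 0`; the case `T
  -- = 0` is treated apart.
  have hquad : 0 ≤ T ^ 2 * S - 2 * T * m * m + m ^ 2 * T := by
    have hnn : 0 ≤ ∫ q, (T ^ 2 * (|a q| * d q ^ 2) - 2 * T * m * (|a q| * |d q|) +
        m ^ 2 * |a q|) ∂ν := by
      refine integral_nonneg fun q => ?_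
      have : T ^ 2 * (|a q| * d q ^ 2) - 2 * T * m * (|a q| * |d q|) + m ^ 2 * |a q| =
          |a q| * (T * |d q| - m) ^ 2 := by
        rw [← sq_abs (d q)]
        ring
      rw [Pi.zero_apply, this]
      positivity
    have h3 : Integrable (fun q => T ^ 2 * (|a q| * d q ^ 2) - 2 * T * m * (|a q| * |d q|)) ν :=
      (h2.const_mul _).sub (h1.const_mul _)
    rwa [integral_add h3 (ha.abs.const_mul _),
      integral_sub (h2.const_mul _) (h1.const_mul _), integral_const_mul, integral_const_mul,
      integral_const_mul] at hnn
  rw [← sq_abs]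
  refine (pow_le_pow_left₀ (abs_nonneg _) habs 2).trans ?_
  rcases hT0.eq_or_lt with h0 | hpos
  · have : m = 0 := le_antisymm (hmT.trans h0.symm.le) hm0
    rw [this, ← h0]
    simp
  · have h3 : 0 ≤ T * (T * S - m ^ 2) := by linarith
    linarith [nonneg_of_mul_nonneg_right h3 hpos]

variable [IsProbabilityMeasure P] [IsFiniteMeasure ν]

theorem memLp_integral_mul {a : α → ℝ} (ha : Integrable a ν) {D : Ω × α → ℝ}
    (hD : AEStronglyMeasurable D (P.prod ν)) (hb : ∀ᵐ p ∂P.prod ν, |D p| ≤ 1) :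
    MemLp (fun ω => ∫ q, a q * D (ω, q) ∂ν) 2 P := by
  have hmeas : AEStronglyMeasurable (fun p : Ω × α => a p.2 * D p) (P.prod ν) :=
    ha.aestronglyMeasurable.comp_snd.mul hD
  refine MemLp.of_bound hmeas.integral_prod_right' (∫ q, |a q| ∂ν) ?_
  filter_upwards [Measure.ae_ae_of_ae_prod hb] with ω hω
  refine norm_integral_le_of_norm_le ha.abs ?_
  filter_upwards [hω] with q hq
  rw [Real.norm_eq_abs, abs_mul]
  exact mul_le_of_le_one_right (abs_nonneg _) hq

/-- Cauchy–Schwarz for each outcome, then Fubini: only the mean square at each fixed `q` enters, so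
correlations between quantiles need no study. -/
theorem integral_sq_integral_mul_le {a : α → ℝ} (ha : Integrable a ν) {D : Ω × α → ℝ}
    (hD : AEStronglyMeasurable D (P.prod ν)) (hb : ∀ᵐ p ∂P.prod ν, |D p| ≤ 1) {V : ℝ}
    (hV : ∀ᵐ q ∂ν, ∫ ω, D (ω, q) ^ 2 ∂P ≤ V) :
    ∫ ω, (∫ q, a q * D (ω, q) ∂ν) ^ 2 ∂P ≤ (∫ q, |a q| ∂ν) ^ 2 * V := by
  have hD2 : AEStronglyMeasurable (fun p => D p ^ 2) (P.prod ν) := hD.pow 2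
  have hint : Integrable (fun p : Ω × α => |a p.2| * D p ^ 2) (P.prod ν) :=
    integrable_mul_of_abs_le_one (a := fun p : Ω × α => |a p.2|) (ha.abs.comp_snd P) hD2
      (hb.mono fun p hp => abs_sq_le_one hp)
  have hT0 : 0 ≤ ∫ q, |a q| ∂ν := integral_nonneg fun q => abs_nonneg _
  calc ∫ ω, (∫ q, a q * D (ω, q) ∂ν) ^ 2 ∂P
      ≤ ∫ ω, (∫ q, |a q| ∂ν) * ∫ q, |a q| * D (ω, q) ^ 2 ∂ν ∂P := by
        refine integral_mono_ae (memLp_integral_mul ha hD hb).integrable_sq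
          (hint.integral_prod_left.const_mul _) ?_
        filter_upwards [Measure.ae_ae_of_ae_prod hb, hD.prodMk_left] with ω hω hmeas
        exact sq_integral_mul_le ha hmeas hω
    _ = (∫ q, |a q| ∂ν) * ∫ q, |a q| * ∫ ω, D (ω, q) ^ 2 ∂P ∂ν := by
        rw [integral_const_mul, integral_integral_swap (f := fun ω q => |a q| * D (ω, q) ^ 2) hint]
        simp_rw [integral_const_mul]
    _ ≤ (∫ q, |a q| ∂ν) * ∫ q, |a q| * V ∂ν := by
        refine mul_le_mul_of_nonneg_left ?_ hT0
        refine integral_mono_ae ?_ (ha.abs.mul_const V) ?_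
        · have := hint.integral_prod_right
          simpa only [integral_const_mul] using this
        · filter_upwards [hV] with q hq
          exact mul_le_mul_of_nonneg_left hq (abs_nonneg _)
    _ = (∫ q, |a q| ∂ν) ^ 2 * V := by
        rw [integral_mul_const]
        ring

end MeanSquare

/-! ### The estimator -/

/-- The weight with which the bid at quantile `q` enters the estimator of `P_k`. -/
noncomputable def estimatorWeight (fmt : PaymentFormat) {n : ℕ} (w : Fin n → ℝ) (k : ℕ)
    (q : ℝ) : ℝ :=
  match fmt with
  | .firstPrice => alloc w q * deriv (zRatio w k) q
  | .allPay => deriv (zRatio w k) q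

section Estimator

variable {fmt : PaymentFormat} {n N : ℕ} {w : Fin n → ℝ} {F : Measure ℝ} [IsProbabilityMeasure F]
  {s : ℝ → ℝ} {c : ℝ}

theorem estimatedRevenue_eq (fmt : PaymentFormat) (w : Fin n → ℝ) (k : ℕ) (B : Fin N → ℝ) :
    estimatedRevenue fmt w k B =
      -∫ q in Set.Icc (0 : ℝ) 1, estimatorWeight fmt w k q * estimatedBid B q := by
  rw [integral_Icc_eq_integral_Ioc, ← intervalIntegral.integral_of_le zero_le_one]
  cases fmt <;> exact intervalIntegral.integral_neg

theorem alloc_pos_of_le_marginalWeight (hw : IsPositionWeights w) (hn : 2 ≤ n) (hc : 0 < c)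
    (hmarg : ∀ k, c ≤ marginalWeight w k) {q : ℝ} (hq : q ∈ Set.Icc (0 : ℝ) 1) :
    0 < alloc w q := by
  refine lt_of_lt_of_le ?_ (weightAt_last_le_alloc hw (by omega) hq)
  refine hc.trans_le ((hmarg ⟨n - 1, by omega⟩).trans (le_of_eq ?_))
  rw [marginalWeight, weightAt_of_le w (by simp only; omega), sub_zero, ← weightAt_coe w]

theorem exists_ne_of_le_marginalWeight (hn : 2 ≤ n) (hc : 0 < c)
    (hmarg : ∀ k, c ≤ marginalWeight w k) : ∃ i j : Fin n, w i ≠ w j := by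
  refine ⟨⟨0, by omega⟩, ⟨1, by omega⟩, fun h => ?_⟩
  have h0 := hmarg ⟨0, by omega⟩
  have h1 : weightAt w 1 = w ⟨1, by omega⟩ := weightAt_coe w ⟨1, by omega⟩
  rw [marginalWeight, h, zero_add, h1, sub_self] at h0
  exact hc.not_ge h0

theorem multiUnitRevenue_eq_integral_quantileBid (fmt : PaymentFormat) (hw : IsPositionWeights w)
    (hF : F (Set.Icc 0 1) = 1) (hFc : Continuous (cdf F)) (hn : 2 ≤ n) (hc : 0 < c)
    (hmarg : ∀ k, c ≤ marginalWeight w k) (k : ℕ) :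
    multiUnitRevenue F n (k + 1) = -∫ q in Set.Icc (0 : ℝ) 1,
      estimatorWeight fmt w (k + 1) q * quantileBid fmt F w q := by
  rw [multiUnitRevenue_eq hF hFc hn hc hmarg, intervalIntegral.integral_of_le zero_le_one,
    ← integral_Icc_eq_integral_Ioc]
  congr 1
  refine setIntegral_congr_fun measurableSet_Icc fun q hq => ?_
  have := (alloc_pos_of_le_marginalWeight hw hn hc hmarg hq).ne'
  cases fmt
  · simp only [estimatorWeight, quantileBid]
    field_simp
  · rfl

theorem continuousOn_estimatorWeight (fmt : PaymentFormat) (hn : 2 ≤ n) (hc : 0 < c)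
    (hmarg : ∀ k, c ≤ marginalWeight w k) (k : ℕ) :
    ContinuousOn (estimatorWeight fmt w (k + 1)) (Set.Icc 0 1) := by
  have h := continuousOn_deriv_of_contDiffAt fun q hq => contDiffAt_zRatio hn hc hmarg k hq
  cases fmt
  · exact (continuous_alloc w).continuousOn.mul h
  · exact h

theorem integral_abs_estimatorWeight_le (fmt : PaymentFormat) (hw : IsPositionWeights w)
    (hn : 2 ≤ n) (hc : 0 < c) (hmarg : ∀ k, c ≤ marginalWeight w k) {k : ℕ} (hk : k < n) :
    ∫ q in Set.Icc (0 : ℝ) 1, |estimatorWeight fmt w (k + 1) q| ≤ 2 * c⁻¹ := by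
  have h := continuousOn_deriv_of_contDiffAt fun q hq => contDiffAt_zRatio hn hc hmarg k hq
  refine le_trans ?_ (integral_abs_deriv_zRatio_le hn hc hmarg hk)
  rw [intervalIntegral.integral_of_le zero_le_one, ← integral_Icc_eq_integral_Ioc]
  refine setIntegral_mono_on
    ((continuousOn_estimatorWeight fmt hn hc hmarg k).integrableOn_Icc).abs
    h.integrableOn_Icc.abs measurableSet_Icc fun q hq => ?_
  cases fmt
  · simp only [estimatorWeight, abs_mul, abs_of_nonneg (hw.alloc_nonneg hq)]
    exact mul_le_of_le_one_left (abs_nonneg _) (hw.alloc_le_one hq)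
  · exact le_rfl

theorem quantileBid_mem_Icc (fmt : PaymentFormat) (hw : IsPositionWeights w)
    (hF : F (Set.Icc 0 1) = 1) (hFc : Continuous (cdf F)) {q : ℝ} (hq : q ∈ Set.Icc (0 : ℝ) 1) :
    quantileBid fmt F w q ∈ Set.Icc (0 : ℝ) 1 := by
  have h0 := quantilePayment_nonneg (w := w) hw hF hFc hq
  have h1 := quantilePayment_le_alloc (w := w) hw hF hFc hq
  cases fmt
  · exact ⟨div_nonneg h0 (hw.alloc_nonneg hq), div_le_one_of_le₀ h1 (hw.alloc_nonneg hq)⟩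
  · exact ⟨h0, h1.trans (hw.alloc_le_one hq)⟩

theorem estimatedBid_mem_Icc {B : Fin N → ℝ} (hB : ∀ j, B j ∈ Set.Icc (0 : ℝ) 1) (q : ℝ) :
    estimatedBid B q ∈ Set.Icc (0 : ℝ) 1 := by
  unfold estimatedBid
  split_ifs
  · exact hB _
  · exact ⟨le_rfl, zero_le_one⟩

theorem isProbabilityMeasure_bids (hs : Measurable s) : IsProbabilityMeasure (F.map s) :=
  Measure.isProbabilityMeasure_map hs.aemeasurable

theorem pi_map_bids (hs : Measurable s) : (Measure.pi fun _ : Fin N => F.map s) =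
    (Measure.pi fun _ : Fin N => F).map fun x j => s (x j) := by
  have := isProbabilityMeasure_bids (F := F) hs
  exact (Measure.pi_map_pi fun _ => hs.aemeasurable).symm

/-- The empirical bid function has mean squared error at most `L² / (2 N)` at every quantile. -/
theorem integral_estimatedBid_sub_sq_le {β : ℝ → ℝ} (hs : Measurable s)
    (hF : F (Set.Icc 0 1) = 1) (hFc : Continuous (cdf F))
    (hsβ : ∀ x ∈ Set.Icc (0 : ℝ) 1, s x = β (cdf F x)) (hβ : MonotoneOn β (Set.Icc 0 1)) {L : ℝ}
    (hL : ∀ p ∈ Set.Icc (0 : ℝ) 1, ∀ q ∈ Set.Icc (0 : ℝ) 1, p ≤ q → β q - β p ≤ L * (q - p))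
    {q : ℝ} (hq : q ∈ Set.Ico (0 : ℝ) 1) (hN : 0 < N) :
    ∫ B, (estimatedBid B q - β q) ^ 2 ∂(Measure.pi fun _ : Fin N => F.map s) ≤
      L ^ 2 * (1 / (2 * N)) := by
  have hnull := nullSingletonClass_of_continuous_cdf F hFc
  have hlam := isProbabilityMeasure_restrict_Icc
  have hN' : (0 : ℝ) < N := Nat.cast_pos.2 hN
  have hqN : 0 ≤ q * N := mul_nonneg hq.1 hN'.le
  -- This needs `q < 1`: at `q = 1` the index would be `N` and `estimatedBid` takes its default
  -- value `0`.
  have hfloor : ⌊q * N⌋₊ < N := (Nat.floor_lt hqN).2 (by nlinarith [hq.2])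
  set i : Fin N := ⟨⌊q * N⌋₊, hfloor⟩
  have hest : ∀ B : Fin N → ℝ, estimatedBid B q = orderStat B i := fun B => by
    rw [estimatedBid, dif_pos ⟨hq.1, hfloor⟩]
    rfl
  have hvec : Measurable fun (x : Fin N → ℝ) j => s (x j) :=
    measurable_pi_iff.2 fun j => hs.comp (measurable_pi_apply j)
  have hvecΦ : Measurable fun (x : Fin N → ℝ) j => cdf F (x j) :=
    measurable_pi_iff.2 fun j => hFc.measurable.comp (measurable_pi_apply j)
  -- The quantiles of the sampled values are independent uniforms, and the monotone `β` carries
  -- their order statistics to those of the bids.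
  have hmap : (Measure.pi fun _ : Fin N => F).map (fun x j => cdf F (x j)) =
      Measure.pi fun _ : Fin N => (volume : Measure ℝ).restrict (Set.Icc 0 1) := by
    have hprob := isProbabilityMeasure_bids (F := F) hFc.measurable
    rw [Measure.pi_map_pi fun _ => hFc.measurable.aemeasurable, map_cdf_eq_restrict hF hFc]
  have hbound := integral_orderStat_sub_sq_le i (q := q) (Nat.floor_le hqN)
    (Nat.lt_floor_add_one _).le
  rw [← hmap, integral_map hvecΦ.aemeasurable
    (((measurable_orderStat i).sub_const q).pow_const 2).aestronglyMeasurable] at hbound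
  simp_rw [hest]
  rw [pi_map_bids hs, integral_map hvec.aemeasurable
    (((measurable_orderStat i).sub_const _).pow_const 2).aestronglyMeasurable]
  refine le_trans ?_ (mul_le_mul_of_nonneg_left hbound (sq_nonneg L))
  rw [← integral_const_mul]
  have hae : ∀ᵐ x ∂(Measure.pi fun _ : Fin N => F), ∀ j, x j ∈ Set.Icc (0 : ℝ) 1 :=
    ae_all_iff.2 fun j => (Measure.quasiMeasurePreserving_eval (fun _ : Fin N => F) j).ae
      (ae_mem_Icc_of_measure_eq_one hF)
  have hqI := Set.Ico_subset_Icc_self hq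
  refine integral_mono_of_nonneg (ae_of_all _ fun x => sq_nonneg _) ?_ ?_
  · refine Integrable.const_mul ?_ _
    refine Integrable.of_bound (C := 1)
      ((((measurable_orderStat i).comp hvecΦ).sub_const q).pow_const 2).aestronglyMeasurable
      (ae_of_all _ fun x => ?_)
    refine abs_sq_le_one ?_
    have h1 : orderStat (fun j => cdf F (x j)) i ∈ Set.Icc (0 : ℝ) 1 := cdf_mem_Icc _
    have h2 : |orderStat (fun j => cdf F (x j)) i - q| ≤ 1 :=
      abs_le.2 ⟨by linarith [h1.1, hqI.2], by linarith [h1.2, hqI.1]⟩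
    exact h2
  · filter_upwards [hae] with x hx
    have hU : ∀ j, cdf F (x j) ∈ Set.Icc (0 : ℝ) 1 := fun j => cdf_mem_Icc _
    have h1 : (fun j => s (x j)) = fun j => β (cdf F (x j)) := funext fun j => hsβ _ (hx j)
    have h2 : orderStat (fun j => cdf F (x j)) i ∈ Set.Icc (0 : ℝ) 1 := hU _
    rw [h1, orderStat_comp hβ hU, ← mul_pow]
    refine sq_le_sq.2 ?_
    rcases le_total q (orderStat (fun j => cdf F (x j)) i) with hle | hle
    · rw [abs_of_nonneg (sub_nonneg.2 (hβ hqI h2 hle))]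
      exact (hL _ hqI _ h2 hle).trans (le_abs_self _)
    · rw [abs_of_nonpos (sub_nonpos.2 (hβ h2 hqI hle)), neg_sub]
      refine (hL _ h2 _ hqI hle).trans ?_
      rw [← neg_sub q, mul_neg, abs_neg]
      exact le_abs_self _

/-- Mean squared error of the estimated multi-unit revenues. -/
theorem IsSymmetricBNE.estimatedRevenue_error (h : IsSymmetricBNE fmt w F s)
    (hw : IsPositionWeights w) (hF : F (Set.Icc 0 1) = 1) (hFc : Continuous (cdf F)) (hn : 2 ≤ n)
    (hc : 0 < c) (hmarg : ∀ k, c ≤ marginalWeight w k) {L : ℝ}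
    (hL : ∀ q ∈ Set.Icc (0 : ℝ) 1, allocSlope fmt w q ≤ L) (hN : 0 < N) {k : ℕ} (hk : k < n) :
    MemLp (fun B : Fin N → ℝ => estimatedRevenue fmt w (k + 1) B - multiUnitRevenue F n (k + 1)) 2
        (Measure.pi fun _ : Fin N => F.map s) ∧
      ∫ B : Fin N → ℝ, (estimatedRevenue fmt w (k + 1) B - multiUnitRevenue F n (k + 1)) ^ 2
        ∂(Measure.pi fun _ : Fin N => F.map s) ≤ (2 * c⁻¹) ^ 2 * (L ^ 2 * (1 / (2 * N))) := by
  obtain ⟨i, j, hij⟩ := exists_ne_of_le_marginalWeight (w := w) hn hc hmarg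
  have hpos : ∀ q ∈ Set.Icc (0 : ℝ) 1, 0 < alloc w q := fun q hq =>
    alloc_pos_of_le_marginalWeight hw hn hc hmarg hq
  have hs := h.measurable
  have hprob := isProbabilityMeasure_bids (F := F) hs
  have hlam := isProbabilityMeasure_restrict_Icc
  set ν := (volume : Measure ℝ).restrict (Set.Icc 0 1) with hν
  set P := Measure.pi fun _ : Fin N => F.map s with hP
  set A := estimatorWeight fmt w (k + 1) with hA
  have hAint : Integrable A ν :=
    (continuousOn_estimatorWeight fmt hn hc hmarg k).integrableOn_Icc
  have hνI : ∀ᵐ q ∂ν, q ∈ Set.Icc (0 : ℝ) 1 := ae_restrict_mem measurableSet_Icc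
  have hβmeas : AEStronglyMeasurable (quantileBid fmt F w) ν :=
    (continuousOn_quantileBid fmt hF hFc hpos).aestronglyMeasurable measurableSet_Icc
  have hbid : ∀ᵐ b ∂(F.map s), b ∈ Set.Icc (0 : ℝ) 1 := by
    refine (mem_ae_map_iff hs.aemeasurable measurableSet_Icc).2 ?_
    filter_upwards [ae_mem_Icc_of_measure_eq_one hF] with x hx
    rw [Set.mem_preimage, h.bid_eq hw hF hFc hij hpos hx]
    exact quantileBid_mem_Icc fmt hw hF hFc (cdf_mem_Icc x)
  have hB : ∀ᵐ B ∂P, ∀ j, B j ∈ Set.Icc (0 : ℝ) 1 := ae_all_iff.2 fun j =>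
    (Measure.quasiMeasurePreserving_eval (fun _ : Fin N => F.map s) j).ae hbid
  set D : (Fin N → ℝ) × ℝ → ℝ := fun p => estimatedBid p.1 p.2 - quantileBid fmt F w p.2 with hD
  have hDmeas : AEStronglyMeasurable D (P.prod ν) :=
    measurable_estimatedBid.aestronglyMeasurable.sub hβmeas.comp_snd
  have hDb : ∀ᵐ p ∂P.prod ν, |D p| ≤ 1 := by
    filter_upwards [(Measure.quasiMeasurePreserving_fst (μ := P) (ν := ν)).ae hB,
      (Measure.quasiMeasurePreserving_snd (μ := P) (ν := ν)).ae hνI] with p hp1 hp2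
    have h1 := estimatedBid_mem_Icc hp1 p.2
    have h2 := quantileBid_mem_Icc fmt hw hF hFc hp2
    exact abs_le.2 ⟨by linarith [h1.1, h2.2], by linarith [h1.2, h2.1]⟩
  have hV : ∀ᵐ q ∂ν, ∫ B, D (B, q) ^ 2 ∂P ≤ L ^ 2 * (1 / (2 * N)) := by
    have hne : ∀ᵐ q ∂ν, q ≠ 1 :=
      measure_eq_zero_iff_ae_notMem.1 (measure_singleton (μ := ν) (1 : ℝ))
    filter_upwards [hνI, hne] with q hq hq1
    exact integral_estimatedBid_sub_sq_le hs hF hFc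
      (fun x hx => h.bid_eq hw hF hFc hij hpos hx)
      (quantileBid_strictMonoOn fmt hw hF hFc hij hpos).monotoneOn
      (fun p hp q hq hpq => quantileBid_sub_le hw hF hFc hpos hL hp hq hpq)
      ⟨hq.1, lt_of_le_of_ne hq.2 hq1⟩ hN
  have heq : ∀ᵐ B ∂P, estimatedRevenue fmt w (k + 1) B - multiUnitRevenue F n (k + 1) =
      -∫ q, A q * D (B, q) ∂ν := by
    filter_upwards [hB] with B hB
    have h1 : Integrable (fun q => A q * estimatedBid B q) ν :=
      integrable_mul_of_abs_le_one hAint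
        (measurable_estimatedBid.comp measurable_prodMk_left).aestronglyMeasurable
        (ae_of_all _ fun q => abs_le.2 ⟨by linarith [(estimatedBid_mem_Icc hB q).1],
          (estimatedBid_mem_Icc hB q).2⟩)
    have h2 : Integrable (fun q => A q * quantileBid fmt F w q) ν :=
      integrable_mul_of_abs_le_one hAint hβmeas (hνI.mono fun q hq => by
        have := quantileBid_mem_Icc fmt hw hF hFc hq
        exact abs_le.2 ⟨by linarith [this.1], this.2⟩)
    rw [estimatedRevenue_eq, multiUnitRevenue_eq_integral_quantileBid fmt hw hF hFc hn hc hmarg]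
    simp only [hD, mul_sub]
    rw [integral_sub h1 h2]
    ring
  have hmem : MemLp (fun B => -∫ q, A q * D (B, q) ∂ν) 2 P :=
    (memLp_integral_mul hAint hDmeas hDb).neg
  refine ⟨hmem.ae_eq (heq.mono fun B hB => hB.symm), ?_⟩
  have hcongr : ∫ B : Fin N → ℝ, (estimatedRevenue fmt w (k + 1) B -
      multiUnitRevenue F n (k + 1)) ^ 2 ∂P = ∫ B, (∫ q, A q * D (B, q) ∂ν) ^ 2 ∂P :=
    integral_congr_ae (heq.mono fun B hB => by beta_reduce; rw [hB, neg_sq])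
  rw [hcongr]
  refine (integral_sq_integral_mul_le hAint hDmeas hDb hV).trans ?_
  refine mul_le_mul_of_nonneg_right ?_ (by positivity)
  exact pow_le_pow_left₀ (integral_nonneg fun q => abs_nonneg _)
    (integral_abs_estimatorWeight_le fmt hw hn hc hmarg hk) 2

end Estimator

/-! ### Mixtures of rank-based auctions -/

section Mixture

variable {n : ℕ} {w : Fin n → ℝ}

theorem weightAt_combination (a b : ℝ) (y z : Fin n → ℝ) (k : ℕ) :
    weightAt (fun j => a * y j + b * z j) k = a * weightAt y k + b * weightAt z k := by
  unfold weightAt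
  split_ifs
  · rfl
  · ring

theorem marginalWeight_combination (a b : ℝ) (y z : Fin n → ℝ) (k : Fin n) :
    marginalWeight (fun j => a * y j + b * z j) k =
      a * marginalWeight y k + b * marginalWeight z k := by
  simp only [marginalWeight, weightAt_combination]
  ring

theorem positionRevenue_combination (F : Measure ℝ) (a b : ℝ) (y z : Fin n → ℝ) :
    positionRevenue F (fun j => a * y j + b * z j) =
      a * positionRevenue F y + b * positionRevenue F z := by
  simp only [positionRevenue, marginalWeight_combination, Finset.mul_sum]
  rw [← Finset.sum_add_distrib]
  exact Finset.sum_congr rfl fun k _ => by ring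

theorem IsRankBasedAuction.combination {y z : Fin n → ℝ} (hy : IsRankBasedAuction w y)
    (hz : IsRankBasedAuction w z) {ε : ℝ} (h0 : 0 ≤ ε) (h1 : ε ≤ 1) :
    IsRankBasedAuction w fun j => (1 - ε) * y j + ε * z j := by
  have h1' : 0 ≤ 1 - ε := sub_nonneg.2 h1
  refine ⟨⟨fun i j hij => add_le_add (mul_le_mul_of_nonneg_left (hy.1.1 hij) h1')
    (mul_le_mul_of_nonneg_left (hz.1.1 hij) h0), fun j => ⟨add_nonneg
      (mul_nonneg h1' (hy.1.2 j).1) (mul_nonneg h0 (hz.1.2 j).1), ?_⟩⟩, fun k hk => ?_⟩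
  · have h2 := mul_le_mul_of_nonneg_left (hy.1.2 j).2 h1'
    have h3 := mul_le_mul_of_nonneg_left (hz.1.2 j).2 h0
    linarith
  · simp only [weightAt_combination]
    rw [Finset.sum_add_distrib, ← Finset.mul_sum, ← Finset.mul_sum]
    have h2 := mul_le_mul_of_nonneg_left (hy.2 k hk) h1'
    have h3 := mul_le_mul_of_nonneg_left (hz.2 k hk) h0
    linarith

theorem marginalWeight_equalMarginalWeights (k : Fin n) :
    marginalWeight (equalMarginalWeights n) k = 1 / n := by
  have hn : (n : ℝ) ≠ 0 := Nat.cast_ne_zero.2 k.pos.ne'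
  unfold marginalWeight weightAt equalMarginalWeights
  split_ifs with h
  · simp only
    push_cast
    field_simp
    ring
  · have hk : (k : ℕ) + 1 = n := by omega
    have hk' : ((k : ℕ) : ℝ) + 1 = n := by exact_mod_cast hk
    rw [sub_zero, ← hk']
    ring

theorem continuous_weightAt (k : ℕ) : Continuous fun y : Fin n → ℝ => weightAt y k := by
  unfold weightAt
  split_ifs
  · exact continuous_apply _
  · exact continuous_const

theorem continuous_positionRevenue (F : Measure ℝ) :
    Continuous fun y : Fin n → ℝ => positionRevenue F y :=
  continuous_finsetSum _ fun k _ =>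
    ((continuous_apply k).sub (continuous_weightAt (k + 1))).mul continuous_const

/-- Finitely many weak linear inequalities inside the unit cube; compactness provides the
revenue-maximizing auction. -/
theorem isCompact_isRankBasedAuction (w : Fin n → ℝ) :
    IsCompact {y : Fin n → ℝ | IsRankBasedAuction w y} := by
  refine (isCompact_Icc (a := (0 : Fin n → ℝ)) (b := 1)).of_isClosed_subset ?_
    fun y hy => ⟨fun j => (hy.1.2 j).1, fun j => (hy.1.2 j).2⟩
  have heq : {y : Fin n → ℝ | IsRankBasedAuction w y} =
      (⋂ i, ⋂ j, ⋂ _ : i ≤ j, {y : Fin n → ℝ | y j ≤ y i}) ∩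
      (⋂ j, {y : Fin n → ℝ | 0 ≤ y j} ∩ {y | y j ≤ 1}) ∩
      ⋂ k, ⋂ _ : k ≤ n, {y : Fin n → ℝ |
        ∑ j ∈ Finset.range k, weightAt y j ≤ ∑ j ∈ Finset.range k, weightAt w j} := by
    ext y
    simp only [Set.mem_inter_iff, Set.mem_iInter]
    exact ⟨fun h => ⟨⟨fun i j hij => h.1.1 hij, h.1.2⟩, h.2⟩,
      fun h => ⟨⟨fun i j hij => h.1.1 i j hij, h.1.2⟩, h.2⟩⟩
  rw [heq]
  refine (IsClosed.inter ?_ ?_).inter ?_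
  · exact isClosed_iInter fun i => isClosed_iInter fun j => isClosed_iInter fun _ =>
      isClosed_le (continuous_apply j) (continuous_apply i)
  · exact isClosed_iInter fun j => (isClosed_le continuous_const (continuous_apply j)).inter
      (isClosed_le (continuous_apply j) continuous_const)
  · exact isClosed_iInter fun k => isClosed_iInter fun _ =>
      isClosed_le (continuous_finsetSum _ fun j _ => continuous_weightAt j) continuous_const

theorem bddAbove_range_allocSlope (fmt : PaymentFormat)
    (hpos : ∀ q ∈ Set.Icc (0 : ℝ) 1, 0 < alloc w q) :
    BddAbove (Set.range fun q : Set.Icc (0 : ℝ) 1 => allocSlope fmt w q) := by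
  have hcont : ContinuousOn (allocSlope fmt w) (Set.Icc 0 1) := by
    cases fmt
    · exact (continuous_deriv_alloc w).continuousOn.div (continuous_alloc w).continuousOn
        fun q hq => (hpos q hq).ne'
    · exact (continuous_deriv_alloc w).continuousOn
  exact (isCompact_range (continuousOn_iff_continuous_domRestrict.1 hcont)).bddAbove

theorem IsPositionWeights.allocSlope_nonneg (hw : IsPositionWeights w) (fmt : PaymentFormat)
    {q : ℝ} (hq : q ∈ Set.Icc (0 : ℝ) 1) : 0 ≤ allocSlope fmt w q := by
  cases fmt
  · exact div_nonneg (hw.deriv_alloc_nonneg hq) (hw.alloc_nonneg hq)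
  · exact hw.deriv_alloc_nonneg hq

end Mixture

end RankAuction

/-! ### The near-optimal mixture and the proof of the theorem -/

theorem mainTheorem3 (n : ℕ) (hn : 2 ≤ n)
    (F : Measure ℝ) [IsProbabilityMeasure F]
    (hF : F (Set.Icc 0 1) = 1) (hF_cont : Continuous (cdf F))
    (w : Fin n → ℝ) (hw : RankAuction.IsPositionWeights w)
    (hw_eq : RankAuction.IsRankBasedAuction w (RankAuction.equalMarginalWeights n))
    (ε : ℝ) (hε : 0 < ε) (hε_le : ε ≤ 1) :
    ∃ y : Fin n → ℝ, RankAuction.IsRankBasedAuction w y ∧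
      -- near-optimality in terms of the multi-unit revenues
      (∀ y', RankAuction.IsRankBasedAuction w y' →
        (1 - ε) * RankAuction.positionRevenue F y' ≤ RankAuction.positionRevenue F y) ∧
      ∀ fmt : PaymentFormat,
        BddAbove (Set.range fun q : Set.Icc (0 : ℝ) 1 => RankAuction.allocSlope fmt y q) ∧
        (∃ s, RankAuction.IsSymmetricBNE fmt y F s) ∧
        ∀ s, RankAuction.IsSymmetricBNE fmt y F s →
          -- near-optimality of the revenue collected in equilibrium
          (∀ y', RankAuction.IsRankBasedAuction w y' → ∀ fmt' s',
            RankAuction.IsSymmetricBNE fmt' y' F s' →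
              (1 - ε) * RankAuction.expectedRevenue fmt' y' F s' ≤
                RankAuction.expectedRevenue fmt y F s) ∧
          -- root mean squared error of the estimated multi-unit revenues from `N` equilibrium bids
          ∀ N : ℕ, 1 ≤ N → ∀ k ∈ Finset.Icc 1 n,
            MemLp (fun B : Fin N → ℝ => RankAuction.estimatedRevenue fmt y k B -
              RankAuction.multiUnitRevenue F n k) 2 (Measure.pi fun _ : Fin N => F.map s) ∧
            √(∫ B : Fin N → ℝ, (RankAuction.estimatedRevenue fmt y k B -
                RankAuction.multiUnitRevenue F n k) ^ 2 ∂(Measure.pi fun _ : Fin N => F.map s)) ≤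
              √(2 / N) * (n / ε) * ⨆ q : Set.Icc (0 : ℝ) 1, RankAuction.allocSlope fmt y q := by
  open RankAuction in
  have hn0 : (0 : ℝ) < n := Nat.cast_pos.2 (by omega)
  obtain ⟨yopt, hyopt, hmax⟩ := (isCompact_isRankBasedAuction w).exists_isMaxOn ⟨_, hw_eq⟩
    (continuous_positionRevenue F).continuousOn
  -- The first part carries the revenue; the second lifts every marginal weight to at least `ε / n`.
  set y : Fin n → ℝ := fun j => (1 - ε) * yopt j + ε * equalMarginalWeights n j with hy
  have hyw : IsRankBasedAuction w y :=
    IsRankBasedAuction.combination hyopt hw_eq hε.le hε_le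
  have hc : 0 < ε / n := div_pos hε hn0
  have hmarg : ∀ k, ε / n ≤ marginalWeight y k := by
    intro k
    rw [hy, marginalWeight_combination, marginalWeight_equalMarginalWeights, mul_one_div]
    exact le_add_of_nonneg_left
      (mul_nonneg (sub_nonneg.2 hε_le) (hyopt.1.marginalWeight_nonneg k))
  have hpos : ∀ q ∈ Set.Icc (0 : ℝ) 1, 0 < alloc y q := fun q hq =>
    alloc_pos_of_le_marginalWeight hyw.1 hn hc hmarg hq
  obtain ⟨i, j, hij⟩ := exists_ne_of_le_marginalWeight (w := y) hn hc hmarg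
  have hopt : ∀ y', IsRankBasedAuction w y' →
      (1 - ε) * positionRevenue F y' ≤ positionRevenue F y := by
    intro y' hy'
    rw [hy, positionRevenue_combination]
    have h1 : positionRevenue F y' ≤ positionRevenue F yopt := hmax hy'
    have h2 := mul_le_mul_of_nonneg_left h1 (sub_nonneg.2 hε_le)
    have h3 := mul_nonneg hε.le (positionRevenue_nonneg hw_eq.1 hF hF_cont)
    linarith
  refine ⟨y, hyw, hopt, fun fmt => ?_⟩
  have hbdd := bddAbove_range_allocSlope fmt hpos
  refine ⟨hbdd, ⟨_, isSymmetricBNE_quantileBid fmt hyw.1 hF hF_cont hij hpos⟩,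
    fun s hs => ⟨fun y' hy' fmt' s' hs' => ?_, fun N hN k hk => ?_⟩⟩
  · rw [hs.expectedRevenue_eq hyw.1 hF hF_cont hij]
    calc (1 - ε) * expectedRevenue fmt' y' F s'
        ≤ (1 - ε) * (n * positionRevenue F y') := mul_le_mul_of_nonneg_left
          (hs'.expectedRevenue_le hy'.1 hF hF_cont) (sub_nonneg.2 hε_le)
      _ = n * ((1 - ε) * positionRevenue F y') := by ring
      _ ≤ n * positionRevenue F y := mul_le_mul_of_nonneg_left (hopt y' hy') hn0.le
  · obtain ⟨hk1, hkn⟩ := Finset.mem_Icc.1 hk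
    obtain ⟨k, rfl⟩ := Nat.exists_eq_add_of_le' hk1
    set L := ⨆ q : Set.Icc (0 : ℝ) 1, allocSlope fmt y q
    have hL : ∀ q ∈ Set.Icc (0 : ℝ) 1, allocSlope fmt y q ≤ L := fun q hq =>
      le_ciSup hbdd (⟨q, hq⟩ : Set.Icc (0 : ℝ) 1)
    have hL0 : 0 ≤ L := (hyw.1.allocSlope_nonneg fmt ⟨le_rfl, zero_le_one⟩).trans
      (hL 0 ⟨le_rfl, zero_le_one⟩)
    obtain ⟨hmem, herr⟩ := hs.estimatedRevenue_error hyw.1 hF hF_cont hn hc hmarg hL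
      (Nat.lt_of_lt_of_le Nat.zero_lt_one hN) (Nat.lt_of_succ_le hkn)
    refine ⟨hmem, Real.sqrt_le_iff.2 ⟨by positivity, herr.trans (le_of_eq ?_)⟩⟩
    have hN0 : (0 : ℝ) < N := Nat.cast_pos.2 hN
    -- With `c = ε / n`, both sides equal `(2 / N) (n / ε)² L²`.
    rw [mul_pow, mul_pow, mul_pow, Real.sq_sqrt (by positivity), inv_div]
    field_simp
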